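/- For each $n$ consider an experiment with $n$ units, of which $n_1$ are treated and $n_0=n-n_1$ are controls; the assignment $(Z_1,\dots,Z_n)\in\{0,1\}^n$ is uniformly distributed over all vectors with exactly $n_1$ ones. Unit $i$ has deterministic potential outcomes $Y_i(1),Y_i(0)\in\mathbb R$ and a deterministic covariate vector $X_i\in\mathbb R^p$, where all these quantities, as well as $p$ and $n_1$, may depend on $n$. The observed outcome is $Y_i=Z_iY_i(1)+(1-Z_i)Y_i(0)$. Write $r_z=n_z/n$; write $\bar a=\frac1n\sum_i a_i$, $S_{a,b}=\frac1{n-1}\sum_i(a_i-\bar a)(b_i-\bar b)^\top$ and $S_a^2=S_{a,a}$ for finite populations $(a_i)$, $(b_i)$ of scalars or vectors, and $\bar Y(z)=\frac1n\sum_iY_i(z)$. Assume that the $p\times p$ matrix $S_X^2$ is invertible for all large $n$, with inverse $S_X^{-2}$. Put \[ H_{ij}=\tfrac1{n-1}(X_i-\bar X)^\top S_X^{-2}(X_j-\bar X),\qquad e_i(z)=Y_i(z)-\bar Y(z)-\bigl(S_X^{-2}S_{X,Y(z)}\bigr)^\top(X_i-\bar X), \] \[ \bar\tau=\frac1n\sum_{i=1}^n\{Y_i(1)-Y_i(0)\},\qquad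 \sigma_{\mathrm{adj}}^2=r_1^{-1}S_{e(1)}^2+r_0^{-1}S_{e(0)}^2-S_{e(1)-e(0)}^2 . \] With $\bar Y_z=\frac1{n_z}\sum_{i:Z_i=z}Y_i$ and $\hat\beta_z=S_X^{-2}\,\frac1{n_z-1}\sum_{i:Z_i=z}(X_i-\bar X)(Y_i-\bar Y_z)$, let \[ \hat\tau_{\mathrm{adj}}=\frac1{n_1}\sum_{i:Z_i=1}\{Y_i-\hat\beta_1^\top(X_i-\bar X)\}-\frac1{n_0}\sum_{i:Z_i=0}\{Y_i-\hat\beta_0^\top(X_i-\bar X)\}, \] \[ \hat\tau_{\mathrm{db}}=\hat\tau_{\mathrm{adj}}+r_1r_0\Bigl(\frac1{n_1}\sum_{i:Z_i=1}H_{ii}\frac{Y_i-\bar Y_1}{r_1^2}-\frac1{n_0}\sum_{i:Z_i=0}H_{ii}\frac{Y_i-\bar Y_0}{r_0^2}\Bigr). \] Theorem. Suppose that, as $n\to\infty$, 1. for $z=0,1$, $r_z$ converges to a limit in $(0,1)$; 2. for $z=0,1$, $\sum_{i=1}^n(Y_i(z)-\bar Y(z))^2=O(n)$; 3. $\max_{z}\max_i|Y_i(z)-\bar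 Y(z)|/\sqrt n\to0$ and $\max_{z}\max_i|e_i(z)|/\sqrt n\to0$; 4. $\liminf_{n\to\infty}\sigma_{\mathrm{adj}}^2>0$; 5. $p/n\to0$ and, for $z=0,1$, the sum of the $p$ largest among the $n$ values $(Y_i(z)-\bar Y(z))^2$, $i=1,\dots,n$, is $o(n)$. Then $\sqrt n\,(\hat\tau_{\mathrm{db}}-\bar\tau)/\sigma_{\mathrm{adj}}$ converges in distribution to $\mathcal N(0,1)$ as $n\to\infty$. (The normalising variance $\sigma^2_{\mathrm{adj}}$ is the one of the regression-adjusted estimator in the regime of fixed $p$.) -/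

import Mathlib

open MeasureTheory ProbabilityTheory Filter Topology Asymptotics
open scoped Matrix

noncomputable section

namespace RegAdj

variable {n p : ℕ}

/-! ### Finite-population quantities for `n` units; arms are labelled by `Fin 2`
(`1` = treatment, `0` = control). -/

/-- The population average of `a₁, …, aₙ`. -/
def mean (a : Fin n → ℝ) : ℝ := (∑ i, a i) / n

/-- The population covariance `S_{a,b}`, with normalisation `n - 1`. -/
def cov (a b : Fin n → ℝ) : ℝ :=
  (∑ i, (a i - mean a) * (b i - mean b)) / ((n : ℝ) - 1)

/-- The population variance `S²_a`. -/
def var (a : Fin n → ℝ) : ℝ := cov a a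

/-- The centred covariate vectors `Xᵢ - X̄`; the rows of `X` are the covariates of the units. -/
def centered (X : Matrix (Fin n) (Fin p) ℝ) (i : Fin n) : Fin p → ℝ :=
  fun j => X i j - mean (fun k => X k j)

/-- The `p × p` covariance matrix `S²_X` of the covariates. -/
def covMatrix (X : Matrix (Fin n) (Fin p) ℝ) : Matrix (Fin p) (Fin p) ℝ :=
  Matrix.of fun j k => cov (fun i => X i j) (fun i => X i k)

/-- The covariance vector `S_{X,y}`. -/
def covVec (X : Matrix (Fin n) (Fin p) ℝ) (y : Fin n → ℝ) : Fin p → ℝ :=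
  fun j => cov (fun i => X i j) y

/-- The hat matrix `H_{ij} = (n-1)⁻¹ (Xᵢ - X̄)ᵀ S_X⁻² (Xⱼ - X̄)`. -/
def hat (X : Matrix (Fin n) (Fin p) ℝ) (i j : Fin n) : ℝ :=
  ((n : ℝ) - 1)⁻¹ * (centered X i ⬝ᵥ ((covMatrix X)⁻¹ *ᵥ centered X j))

/-- The population regression coefficient of `y` on `X`. -/
def popBeta (X : Matrix (Fin n) (Fin p) ℝ) (y : Fin n → ℝ) : Fin p → ℝ :=
  (covMatrix X)⁻¹ *ᵥ covVec X y

/-- The population regression residuals `eᵢ` of `y` on `X`. -/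
def resid (X : Matrix (Fin n) (Fin p) ℝ) (y : Fin n → ℝ) (i : Fin n) : ℝ :=
  y i - mean y - popBeta X y ⬝ᵥ centered X i

/-- The asymptotic variance `σ²_adj = S²_{e(1)}/r₁ + S²_{e(0)}/r₀ - S²_{e(1)-e(0)}`,
where `r z` is the proportion of units in arm `z` and `Y z i` the potential outcome of
unit `i` under arm `z`. -/
def sigmaAdjSq (X : Matrix (Fin n) (Fin p) ℝ) (r : Fin 2 → ℝ) (Y : Fin 2 → Fin n → ℝ) : ℝ :=
  (r 1)⁻¹ * var (resid X (Y 1)) + (r 0)⁻¹ * var (resid X (Y 0))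
    - var (fun i => resid X (Y 1) i - resid X (Y 0) i)

/-- The sample average treatment effect. -/
def ate (Y : Fin 2 → Fin n → ℝ) : ℝ := mean (fun i => Y 1 i - Y 0 i)

/-- The sum of the `k` largest entries of `f` (of all entries if `k ≥ n`): `f` is listed in
decreasing order and its first `k` terms are added. -/
def sumLargest (k : ℕ) (f : Fin n → ℝ) : ℝ :=
  ∑ i : Fin n with i.val < k, f (Tuple.sort (fun j => OrderDual.toDual (f j)) i)

/-! ### Estimators: functions of the covariates, the assignment `Z` and the observed outcomes -/

/-- The observed outcomes: unit `i` reveals the potential outcome of its assigned arm. -/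
def observed (Y : Fin 2 → Fin n → ℝ) (Z : Fin n → Fin 2) (i : Fin n) : ℝ := Y (Z i) i

/-- The number `n_z` of units assigned to arm `z`. -/
def armSize (Z : Fin n → Fin 2) (z : Fin 2) : ℕ := Fintype.card {i // Z i = z}

/-- The proportion `r_z = n_z / n` of units assigned to arm `z`. -/
def armProp (Z : Fin n → Fin 2) (z : Fin 2) : ℝ := (armSize Z z : ℝ) / n

/-- The average of `a` over the units assigned to arm `z`. -/
def armMean (Z : Fin n → Fin 2) (a : Fin n → ℝ) (z : Fin 2) : ℝ :=
  (∑ i with Z i = z, a i) / armSize Z z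

/-- The empirical covariance vector `s_{X,Y(z)}` computed from the units in arm `z`. -/
def armCovVec (X : Matrix (Fin n) (Fin p) ℝ) (Z : Fin n → Fin 2) (y : Fin n → ℝ) (z : Fin 2) :
    Fin p → ℝ :=
  fun j => (∑ i with Z i = z, centered X i j * (y i - armMean Z y z)) / ((armSize Z z : ℝ) - 1)

/-- The estimated coefficient `β̂_z = S_X⁻² s_{X,Y(z)}`; the covariance matrix is that of all
`n` units. -/
def betaHat (X : Matrix (Fin n) (Fin p) ℝ) (Z : Fin n → Fin 2) (y : Fin n → ℝ) (z : Fin 2) :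
    Fin p → ℝ :=
  (covMatrix X)⁻¹ *ᵥ armCovVec X Z y z

/-- The regression-adjusted estimator. -/
def tauAdj (X : Matrix (Fin n) (Fin p) ℝ) (Z : Fin n → Fin 2) (y : Fin n → ℝ) : ℝ :=
  armMean Z (fun i => y i - betaHat X Z y 1 ⬝ᵥ centered X i) 1
    - armMean Z (fun i => y i - betaHat X Z y 0 ⬝ᵥ centered X i) 0

/-- The debiased regression-adjusted estimator. -/
def tauDb (X : Matrix (Fin n) (Fin p) ℝ) (Z : Fin n → Fin 2) (y : Fin n → ℝ) : ℝ :=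
  tauAdj X Z y + armProp Z 1 * armProp Z 0 *
    (armMean Z (fun i => hat X i i * ((y i - armMean Z y 1) / armProp Z 1 ^ 2)) 1
      - armMean Z (fun i => hat X i i * ((y i - armMean Z y 0) / armProp Z 0 ^ 2)) 0)

/-- The law of a completely randomized assignment with `n₁` treated units: uniform over all
assignments which send exactly `n₁` units to arm `1`. -/
def completeRandomization (n n₁ : ℕ) : Measure (Fin n → Fin 2) :=
  uniformOn {Z | armSize Z 1 = n₁}

end RegAdj

end

open scoped BigOperators

noncomputable section

namespace RegAdj

variable {n : ℕ}

/-! ### Moments of a completely randomized assignment -/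

/-! Let T_i be the indicator of an arm minus the arm's proportion, and let y be the centred
outcomes. Within one arm, the regression correction is a quadratic form in the indicators whose
matrix is the hat matrix H. Since T_i² is affine in T_i, the form splits into a linear part that
turns outcomes into residuals, a constant proportional to ∑ H_ii y_i, a linear form with
coefficients H_ii y_i, and an off-diagonal quadratic form (`sum_hat_ind`). The constant is the bias;
Cauchy–Schwarz alone does not make it o(n^(-1/2)) when p grows. The debiasing term cancels it up to
an extra factor of order 1/n (`armEst_sub_eq`).

The two centred forms that remain have second moments at most a constant times ∑ H_ii y_i². As H is
a projection of trace p, its diagonal lies in [0, 1] and sums to p, so this sum is at most the sum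
of the p largest y_i² (`sum_mul_le_sumLargest`), which is o(n). The products created by centring at
the arm mean are small because p/n → 0. All moments come from exchangeability: since the T_i sum to
zero, an index that occurs only once gains a factor 1/n (`card_sub_mul_expect_dev`), and a Schur
test turns entrywise moment bounds into bounds for forms.

What is left is a linear statistic W in the residuals, scaled to variance one. Swapping a treated
unit with a control gives an exchangeable pair, and Stein's argument applied to exp(itW) shows that
the characteristic function nearly solves φ' = -tφ (`norm_expect_mul_cexp_sub_le`). Integrating this
and comparing with the estimator gives pointwise convergence of characteristic functions, hence
convergence in law. -/

/-- The assignments that send exactly `k` units to arm `z`. -/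
def assignments (n : ℕ) (z : Fin 2) (k : ℕ) : Finset (Fin n → Fin 2) :=
  Finset.univ.filter fun Z => armSize Z z = k

/-- The centred indicator of arm `z`. -/
def dev (z : Fin 2) (k : ℕ) (Z : Fin n → Fin 2) (i : Fin n) : ℝ :=
  (if Z i = z then 1 else 0) - (k : ℝ) / n

lemma armSize_eq_sum (Z : Fin n → Fin 2) (z : Fin 2) :
    (armSize Z z : ℝ) = ∑ i, if Z i = z then (1 : ℝ) else 0 := by
  simp [armSize, Fintype.card_subtype]

lemma armSize_comp (Z : Fin n → Fin 2) (z : Fin 2) (σ : Equiv.Perm (Fin n)) :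
    armSize (Z ∘ σ) z = armSize Z z :=
  Fintype.card_congr (σ.subtypeEquiv fun _ => Iff.rfl)

lemma mem_assignments {z : Fin 2} {k : ℕ} {Z : Fin n → Fin 2} :
    Z ∈ assignments n z k ↔ armSize Z z = k := by
  simp [assignments]

lemma assignments_nonempty {z : Fin 2} {k : ℕ} (hk : k ≤ n) : (assignments n z k).Nonempty := by
  obtain ⟨s, hs⟩ := Finset.exists_subset_card_eq (s := (Finset.univ : Finset (Fin n))) (n := k)
    (by simpa using hk)
  -- In `Fin 2`, `z + 1` is the other arm.
  refine ⟨fun i => if i ∈ s then z else z + 1, mem_assignments.2 ?_⟩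
  rw [armSize, Fintype.card_subtype, ← hs.2]
  congr 1
  ext i
  by_cases hi : i ∈ s
  · simp [hi]
  · simp [hi]

lemma expect_comp_perm {M : Type*} [AddCommMonoid M] [Module ℚ≥0 M] {z : Fin 2} {k : ℕ}
    (σ : Equiv.Perm (Fin n)) (f : (Fin n → Fin 2) → M) :
    𝔼 Z ∈ assignments n z k, f (Z ∘ σ) = 𝔼 Z ∈ assignments n z k, f Z := by
  refine Finset.expect_equiv (σ.symm.arrowCongr (Equiv.refl _)) (fun Z => ?_) (fun Z _ => ?_)
  · rw [mem_assignments, mem_assignments]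
    exact (iff_of_eq (congrArg (· = k) (armSize_comp Z z σ))).symm
  · rfl

lemma dev_comp (z : Fin 2) (k : ℕ) (Z : Fin n → Fin 2) (σ : Equiv.Perm (Fin n)) (i : Fin n) :
    dev z k (Z ∘ σ) i = dev z k Z (σ i) := rfl

lemma sum_dev {z : Fin 2} {k : ℕ} (hn : 0 < n) {Z : Fin n → Fin 2} (hZ : Z ∈ assignments n z k) :
    ∑ i, dev z k Z i = 0 := by
  have hn' : (n : ℝ) ≠ 0 := by positivity
  simp only [dev, Finset.sum_sub_distrib]
  rw [← armSize_eq_sum, mem_assignments.1 hZ]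
  simp
  field_simp
  simp

lemma abs_dev_le {z : Fin 2} {k : ℕ} (hk : k ≤ n) (Z : Fin n → Fin 2) (i : Fin n) :
    |dev z k Z i| ≤ 1 := by
  have h0 : 0 ≤ (k : ℝ) / n := by positivity
  have h1 : (k : ℝ) / n ≤ 1 := div_le_one_of_le₀ (by exact_mod_cast hk) (by positivity)
  rw [abs_le, dev]
  split_ifs <;> constructor <;> linarith

lemma abs_expect_le_of_le {α : Type*} {s : Finset α} {f : α → ℝ} {c : ℝ} (hc : 0 ≤ c)
    (h : ∀ a ∈ s, |f a| ≤ c) : |𝔼 a ∈ s, f a| ≤ c := by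
  rcases s.eq_empty_or_nonempty with rfl | hs
  · simpa
  · exact (Finset.abs_expect_le s f).trans (Finset.expect_le hs h)

/-- If `F` is invariant under the transpositions of units outside `A`, then the mixed moments
`E[F Tₗ]` agree for all `l ∉ A`, and they sum to zero with those for `l ∈ A`. -/
lemma card_sub_mul_expect_dev {z : Fin 2} {k : ℕ} (F : (Fin n → Fin 2) → ℝ) (A : Finset (Fin n))
    (hF : ∀ l l' : Fin n, l ∉ A → l' ∉ A → ∀ Z, F (Z ∘ Equiv.swap l l') = F Z)
    {l : Fin n} (hl : l ∉ A) :
    ((n : ℝ) - A.card) * 𝔼 Z ∈ assignments n z k, F Z * dev z k Z l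
      = - ∑ a ∈ A, 𝔼 Z ∈ assignments n z k, F Z * dev z k Z a := by
  have hn : 0 < n := l.pos
  have h0 : ∑ a, 𝔼 Z ∈ assignments n z k, F Z * dev z k Z a = 0 := by
    rw [← Finset.expect_sum_comm]
    refine Finset.expect_eq_zero fun Z hZ => ?_
    rw [← Finset.mul_sum, sum_dev hn hZ, mul_zero]
  rw [← Finset.sum_add_sum_compl A] at h0
  have h1 : ∀ a ∈ Aᶜ, 𝔼 Z ∈ assignments n z k, F Z * dev z k Z a
      = 𝔼 Z ∈ assignments n z k, F Z * dev z k Z l := by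
    intro a ha
    rw [← expect_comp_perm (Equiv.swap l a)]
    refine Finset.expect_congr rfl fun Z _ => ?_
    rw [hF l a hl (by simpa using ha), dev_comp, Equiv.swap_apply_right]
  rw [Finset.sum_congr rfl h1, Finset.sum_const, nsmul_eq_mul, Finset.card_compl,
    Nat.cast_sub (by simpa using Finset.card_le_univ A), Fintype.card_fin] at h0
  linarith

lemma dev_comp_swap {z : Fin 2} {k : ℕ} {i l l' : Fin n} (h : i ≠ l) (h' : i ≠ l')
    (Z : Fin n → Fin 2) : dev z k (Z ∘ Equiv.swap l l') i = dev z k Z i := by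
  rw [dev_comp, Equiv.swap_apply_of_ne_of_ne h h']

/-- Isolating `j` by exchangeability leaves a trivially bounded moment divided by n - 1, and n - 1 ≥
n / 2. -/
lemma abs_expect_dev_two_le {z : Fin 2} {k : ℕ} (hk : k ≤ n) (hn : 2 ≤ n) {i j : Fin n}
    (hij : i ≠ j) : |𝔼 Z ∈ assignments n z k, dev z k Z i * dev z k Z j| ≤ 2 / n := by
  have h := card_sub_mul_expect_dev (z := z) (k := k) (fun Z => dev z k Z i) {i}
    (fun l l' hl hl' Z => dev_comp_swap (by simpa [eq_comm] using hl)
      (by simpa [eq_comm] using hl') Z) (l := j) (by simpa using hij.symm)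
  simp only [Finset.card_singleton, Finset.sum_singleton, Nat.cast_one] at h
  have hb : |𝔼 Z ∈ assignments n z k, dev z k Z i * dev z k Z i| ≤ 1 :=
    abs_expect_le_of_le zero_le_one fun Z _ => by
      rw [abs_mul]; exact mul_le_one₀ (abs_dev_le hk Z i) (abs_nonneg _) (abs_dev_le hk Z i)
  have hn2 : (2 : ℝ) ≤ n := by exact_mod_cast hn
  have h' := congrArg abs h
  rw [abs_mul, abs_neg, abs_of_nonneg (by linarith : (0 : ℝ) ≤ n - 1)] at h'
  rw [le_div_iff₀ (by linarith)]
  nlinarith [abs_nonneg (𝔼 Z ∈ assignments n z k, dev z k Z i * dev z k Z j)]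

/-- Only one factor 1/n is gained: isolating `l` produces E[Tᵢ²Tⱼ²], which has order 1. -/
lemma abs_expect_dev_three_le {z : Fin 2} {k : ℕ} (hk : k ≤ n) (hn : 6 ≤ n) {i j l : Fin n}
    (hij : i ≠ j) (hil : i ≠ l) (hjl : j ≠ l) :
    |𝔼 Z ∈ assignments n z k, dev z k Z i ^ 2 * dev z k Z j * dev z k Z l| ≤ 4 / n := by
  have h := card_sub_mul_expect_dev (z := z) (k := k) (fun Z => dev z k Z i ^ 2 * dev z k Z j) {i, j}
    (fun l l' hl hl' Z => by
      simp only [Finset.mem_insert, Finset.mem_singleton, not_or] at hl hl'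
      rw [dev_comp_swap (Ne.symm hl.1) (Ne.symm hl'.1), dev_comp_swap (Ne.symm hl.2) (Ne.symm hl'.2)])
    (l := l) (by simp [hil.symm, hjl.symm])
  rw [Finset.card_pair hij, Finset.sum_pair hij] at h
  have hb : ∀ a, |𝔼 Z ∈ assignments n z k, dev z k Z i ^ 2 * dev z k Z j * dev z k Z a| ≤ 1 :=
    fun a => abs_expect_le_of_le zero_le_one fun Z _ => by
      rw [abs_mul, abs_mul, abs_pow]
      exact mul_le_one₀ (mul_le_one₀ (pow_le_one₀ (abs_nonneg _) (abs_dev_le hk Z i)) (abs_nonneg _)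
        (abs_dev_le hk Z j)) (abs_nonneg _) (abs_dev_le hk Z a)
  have hn2 : (6 : ℝ) ≤ n := by exact_mod_cast hn
  have h' := congrArg abs h
  push_cast at h'
  rw [abs_mul, abs_neg, abs_of_nonneg (by linarith : (0 : ℝ) ≤ n - 2)] at h'
  have h2 := (abs_add_le _ _).trans (add_le_add (hb i) (hb j))
  rw [le_div_iff₀ (by linarith)]
  nlinarith [abs_nonneg (𝔼 Z ∈ assignments n z k, dev z k Z i ^ 2 * dev z k Z j * dev z k Z l)]

/-- Isolating `o` reduces to three moments with one repeated index, each already of order 1/n, so a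
second factor 1/n is gained. The hypothesis 6 ≤ n serves n - 3 ≥ n / 2, which doubles 12 to 24. -/
lemma abs_expect_dev_four_le {z : Fin 2} {k : ℕ} (hk : k ≤ n) (hn : 6 ≤ n) {i j l o : Fin n}
    (hij : i ≠ j) (hil : i ≠ l) (hio : i ≠ o) (hjl : j ≠ l) (hjo : j ≠ o) (hlo : l ≠ o) :
    |𝔼 Z ∈ assignments n z k, dev z k Z i * dev z k Z j * dev z k Z l * dev z k Z o|
      ≤ 24 / n ^ 2 := by
  have h := card_sub_mul_expect_dev (z := z) (k := k)
    (fun Z => dev z k Z i * dev z k Z j * dev z k Z l) {i, j, l}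
    (fun l l' hl hl' Z => by
      simp only [Finset.mem_insert, Finset.mem_singleton, not_or] at hl hl'
      rw [dev_comp_swap (Ne.symm hl.1) (Ne.symm hl'.1),
        dev_comp_swap (Ne.symm hl.2.1) (Ne.symm hl'.2.1),
        dev_comp_swap (Ne.symm hl.2.2) (Ne.symm hl'.2.2)])
    (l := o) (by simp [hio.symm, hjo.symm, hlo.symm])
  rw [Finset.card_eq_three.2 ⟨i, j, l, hij, hil, hjl, rfl⟩, Finset.sum_insert (by simp [hij, hil]),
    Finset.sum_pair hjl] at h
  have h1 := abs_expect_dev_three_le (z := z) hk hn hij hil hjl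
  have h2 := abs_expect_dev_three_le (z := z) hk hn hij.symm hjl hil
  have h3 := abs_expect_dev_three_le (z := z) hk hn hil.symm hjl.symm hij
  have hn2 : (6 : ℝ) ≤ n := by exact_mod_cast hn
  have e1 : 𝔼 Z ∈ assignments n z k, dev z k Z i * dev z k Z j * dev z k Z l * dev z k Z i
      = 𝔼 Z ∈ assignments n z k, dev z k Z i ^ 2 * dev z k Z j * dev z k Z l :=
    Finset.expect_congr rfl fun Z _ => by ring
  have e2 : 𝔼 Z ∈ assignments n z k, dev z k Z i * dev z k Z j * dev z k Z l * dev z k Z j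
      = 𝔼 Z ∈ assignments n z k, dev z k Z j ^ 2 * dev z k Z i * dev z k Z l :=
    Finset.expect_congr rfl fun Z _ => by ring
  have e3 : 𝔼 Z ∈ assignments n z k, dev z k Z i * dev z k Z j * dev z k Z l * dev z k Z l
      = 𝔼 Z ∈ assignments n z k, dev z k Z l ^ 2 * dev z k Z i * dev z k Z j :=
    Finset.expect_congr rfl fun Z _ => by ring
  rw [e1, e2, e3] at h
  have h' := congrArg abs h
  push_cast at h'
  rw [abs_mul, abs_neg, abs_of_nonneg (by linarith : (0 : ℝ) ≤ n - 3)] at h'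
  have h4 := (abs_add_le _ _).trans (add_le_add h1 ((abs_add_le _ _).trans (add_le_add h2 h3)))
  rw [← h'] at h4
  have h5 : (n : ℝ) * |𝔼 Z ∈ assignments n z k,
      dev z k Z i * dev z k Z j * dev z k Z l * dev z k Z o| ≤ 24 / n := by
    have : (24 : ℝ) / n = 2 * (4 / n + (4 / n + 4 / n)) := by ring
    rw [this]
    nlinarith [abs_nonneg (𝔼 Z ∈ assignments n z k,
      dev z k Z i * dev z k Z j * dev z k Z l * dev z k Z o)]
  rw [le_div_iff₀ (by positivity)]
  rw [le_div_iff₀ (by linarith)] at h5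
  linarith

/-! ### Second moments of linear and quadratic forms in the centred indicators -/

/-- A Schur test for quadratic forms. -/
lemma sum_sum_mul_le {α : Type*} [Fintype α] {x : α → ℝ} {m w : α → α → ℝ} {C : ℝ}
    (hmw : ∀ a b, x a ≠ 0 → x b ≠ 0 → |m a b| ≤ w a b) (hw : ∀ a b, w a b = w b a)
    (hw0 : ∀ a b, 0 ≤ w a b) (hC : ∀ a, ∑ b, w a b ≤ C) :
    ∑ a, ∑ b, x a * x b * m a b ≤ C * ∑ a, x a ^ 2 := by
  -- The bound on `m` is needed only where `x` does not vanish. For quadratic forms this discards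
  -- the pairs with equal indices, to which the moment bounds do not apply.
  have key : ∀ a b, x a * x b * m a b ≤ x a ^ 2 / 2 * w a b + x b ^ 2 / 2 * w b a := by
    intro a b
    rw [hw b a]
    have hr : 0 ≤ x a ^ 2 / 2 * w a b + x b ^ 2 / 2 * w a b := by
      have := hw0 a b
      positivity
    by_cases ha : x a = 0
    · simpa [ha] using hr
    by_cases hb : x b = 0
    · simpa [hb] using hr
    have h1 : x a * x b * m a b ≤ |x a * x b| * w a b :=
      (le_abs_self _).trans (by rw [abs_mul]; gcongr; exact hmw a b ha hb)
    have h2 : |x a * x b| ≤ x a ^ 2 / 2 + x b ^ 2 / 2 := by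
      rw [abs_le]; constructor <;> nlinarith [sq_nonneg (x a + x b), sq_nonneg (x a - x b)]
    nlinarith [hw0 a b]
  have h1 : ∑ a, ∑ b, x a ^ 2 / 2 * w a b ≤ C / 2 * ∑ a, x a ^ 2 := by
    rw [Finset.mul_sum]
    refine Finset.sum_le_sum fun a _ => ?_
    rw [← Finset.mul_sum]
    nlinarith [hC a, sq_nonneg (x a)]
  calc _ ≤ ∑ a, ∑ b, (x a ^ 2 / 2 * w a b + x b ^ 2 / 2 * w b a) :=
        Finset.sum_le_sum fun a _ => Finset.sum_le_sum fun b _ => key a b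
    _ = ∑ a, ∑ b, x a ^ 2 / 2 * w a b + ∑ a, ∑ b, x a ^ 2 / 2 * w a b := by
        simp only [Finset.sum_add_distrib]
        congr 1
        exact Finset.sum_comm
    _ ≤ _ := by linarith

lemma expect_sum_sq_eq {α β : Type*} [Fintype α] (s : Finset β) (x : α → ℝ) (f : α → β → ℝ) :
    𝔼 Z ∈ s, (∑ a, x a * f a Z) ^ 2 = ∑ a, ∑ b, x a * x b * 𝔼 Z ∈ s, f a Z * f b Z := by
  simp only [Finset.mul_expect]
  rw [← Finset.sum_congr rfl fun a _ => Finset.expect_sum_comm _ _ _, ← Finset.expect_sum_comm]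
  refine Finset.expect_congr rfl fun Z _ => ?_
  rw [sq, Finset.sum_mul_sum]
  exact Finset.sum_congr rfl fun a _ => Finset.sum_congr rfl fun b _ => by ring

/-- Schur test with weight 1 on the diagonal and 2/n elsewhere; a row sums to 1 + n · (2/n) = 3. -/
lemma expect_linear_sq_le {z : Fin 2} {k : ℕ} (hk : k ≤ n) (hn : 2 ≤ n) (a : Fin n → ℝ) :
    𝔼 Z ∈ assignments n z k, (∑ i, a i * dev z k Z i) ^ 2 ≤ 3 * ∑ i, a i ^ 2 := by
  rw [expect_sum_sq_eq]
  refine sum_sum_mul_le (w := fun i j => (if i = j then 1 else 0) + 2 / (n : ℝ)) ?_ ?_ ?_ ?_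
  · intro i j _ _
    by_cases hij : i = j
    · subst hij
      have : |𝔼 Z ∈ assignments n z k, dev z k Z i * dev z k Z i| ≤ 1 :=
        abs_expect_le_of_le zero_le_one fun Z _ => by
          rw [abs_mul]; exact mul_le_one₀ (abs_dev_le hk Z i) (abs_nonneg _) (abs_dev_le hk Z i)
      simp only [if_true]
      have h2 : 0 ≤ 2 / (n : ℝ) := by positivity
      linarith
    · simpa [hij] using abs_expect_dev_two_le hk hn hij
  · intro i j
    simp [eq_comm]
  · intro i j
    positivity
  · intro i
    have : (n : ℝ) ≠ 0 := by positivity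
    simp only [Finset.sum_add_distrib, Finset.sum_ite_eq, Finset.mem_univ, if_true,
      Finset.sum_const, Finset.card_univ, Fintype.card_fin, nsmul_eq_mul]
    rw [mul_div_cancel₀ _ this]
    norm_num

/-- The bound for `E[TᵢTⱼTₗTₒ]`. -/
def quadWeight (n : ℕ) (a b : Fin n × Fin n) : ℝ :=
  (if a.1 = b.1 ∧ a.2 = b.2 then 1 else 0) + (if a.1 = b.2 ∧ a.2 = b.1 then 1 else 0)
    + 4 / n * ((if a.1 = b.1 then 1 else 0) + (if a.1 = b.2 then 1 else 0)
      + ((if a.2 = b.1 then 1 else 0) + (if a.2 = b.2 then 1 else 0))) + 24 / n ^ 2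

/-- The size is governed by the coincidences between the two pairs: both indices matched gives at
most 1, one shared index 4/n, none 24/n². -/
lemma abs_expect_dev_pair_le {z : Fin 2} {k : ℕ} (hk : k ≤ n) (hn : 6 ≤ n) {a b : Fin n × Fin n}
    (ha : a.1 ≠ a.2) (hb : b.1 ≠ b.2) :
    |𝔼 Z ∈ assignments n z k, dev z k Z a.1 * dev z k Z a.2 * (dev z k Z b.1 * dev z k Z b.2)|
      ≤ quadWeight n a b := by
  obtain ⟨i, j⟩ := a
  obtain ⟨l, o⟩ := b
  simp only at ha hb
  have h4 : (0 : ℝ) ≤ 4 / n := by positivity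
  have h24 : (0 : ℝ) ≤ 24 / n ^ 2 := by positivity
  have hone : |𝔼 Z ∈ assignments n z k, dev z k Z i * dev z k Z j * (dev z k Z l * dev z k Z o)| ≤ 1 :=
    abs_expect_le_of_le zero_le_one fun Z _ => by
      rw [abs_mul, abs_mul, abs_mul]
      exact mul_le_one₀ (mul_le_one₀ (abs_dev_le hk Z i) (abs_nonneg _) (abs_dev_le hk Z j))
        (by positivity) (mul_le_one₀ (abs_dev_le hk Z l) (abs_nonneg _) (abs_dev_le hk Z o))
  have three : ∀ u v w : Fin n, u ≠ v → u ≠ w → v ≠ w →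
      (∀ Z, dev z k Z i * dev z k Z j * (dev z k Z l * dev z k Z o)
        = dev z k Z u ^ 2 * dev z k Z v * dev z k Z w) →
      |𝔼 Z ∈ assignments n z k, dev z k Z i * dev z k Z j * (dev z k Z l * dev z k Z o)|
        ≤ 4 / n := by
    intro u v w h1 h2 h3 h
    rw [Finset.expect_congr rfl fun Z _ => h Z]
    exact abs_expect_dev_three_le hk hn h1 h2 h3
  simp only [quadWeight]
  by_cases hil : i = l
  · subst hil
    by_cases hjo : j = o
    · subst hjo
      simp only [ha, ha.symm, if_true, if_false, and_self]
      linarith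
    · have := three i j o ha hb hjo fun Z => by ring
      simp only [ha.symm, hb, hjo, if_true, if_false, and_self, and_false]
      linarith
  · by_cases hio : i = o
    · subst hio
      by_cases hjl : j = l
      · subst hjl
        simp only [ha, ha.symm, if_true, if_false, and_self]
        linarith
      · have := three i j l ha hil hjl fun Z => by ring
        simp only [hil, hjl, ha.symm, if_true, if_false, and_self, and_false]
        linarith
    · by_cases hjl : j = l
      · subst hjl
        have := three j i o ha.symm hb hio fun Z => by ring
        simp only [ha, hio, hb, if_true, if_false, and_self, false_and]
        linarith
      · by_cases hjo : j = o
        · subst hjo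
          have := three j i l ha.symm hb.symm hil fun Z => by ring
          simp only [hil, ha, hjl, if_true, if_false, and_self, false_and]
          linarith
        · have := abs_expect_dev_four_le (z := z) hk hn ha hil hio hjl hjo hb
          simp only [hil, hio, hjl, hjo, if_false, and_self]
          simp only [mul_assoc] at this ⊢
          linarith

/-- The two complete matchings contribute 1 each, the four single coincidences (4/n) · n each, and
the constant term 24. -/
lemma sum_quadWeight (hn : 0 < n) (a : Fin n × Fin n) : ∑ b, quadWeight n a b = 42 := by
  have hn' : (n : ℝ) ≠ 0 := by positivity
  have h1 : ∑ b : Fin n × Fin n, (if a.1 = b.1 ∧ a.2 = b.2 then (1 : ℝ) else 0) = 1 := by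
    simp [← Prod.ext_iff]
  have h2 : ∑ b : Fin n × Fin n, (if a.1 = b.2 ∧ a.2 = b.1 then (1 : ℝ) else 0) = 1 := by
    rw [Fintype.sum_eq_single (a.2, a.1)]
    · simp
    · rintro ⟨b1, b2⟩ hb
      rw [if_neg]
      rintro ⟨h, h'⟩
      exact hb (by simp [h, h'])
  have h3 : ∀ c : Fin n, ∑ b : Fin n × Fin n, (if c = b.1 then (1 : ℝ) else 0) = n := by
    intro c
    rw [Fintype.sum_prod_type_right]
    simp
  have h4 : ∀ c : Fin n, ∑ b : Fin n × Fin n, (if c = b.2 then (1 : ℝ) else 0) = n := by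
    intro c
    rw [Fintype.sum_prod_type]
    simp
  simp only [quadWeight, Finset.sum_add_distrib, ← Finset.mul_sum]
  rw [h1, h2, h3, h4, h3, h4]
  simp only [Finset.sum_const, Finset.card_univ, Fintype.card_prod, Fintype.card_fin, nsmul_eq_mul]
  push_cast
  field_simp
  ring

lemma expect_quadratic_sq_le {z : Fin 2} {k : ℕ} (hk : k ≤ n) (hn : 6 ≤ n)
    (B : Fin n → Fin n → ℝ) (hB : ∀ i, B i i = 0) :
    𝔼 Z ∈ assignments n z k, (∑ i, ∑ j, B i j * (dev z k Z i * dev z k Z j)) ^ 2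
      ≤ 42 * ∑ i, ∑ j, B i j ^ 2 := by
  have h := sum_sum_mul_le (x := fun a : Fin n × Fin n => B a.1 a.2)
    (m := fun a b => 𝔼 Z ∈ assignments n z k,
      dev z k Z a.1 * dev z k Z a.2 * (dev z k Z b.1 * dev z k Z b.2))
    (w := quadWeight n) (C := 42)
    (fun a b ha hb => abs_expect_dev_pair_le hk hn
      (fun h => ha (by rw [h]; exact hB _)) (fun h => hb (by rw [h]; exact hB _)))
    (fun a b => by
      simp only [quadWeight, eq_comm (a := a.1), eq_comm (a := a.2), and_comm (a := b.2 = a.1)]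
      ring)
    (fun a b => by unfold quadWeight; positivity)
    (fun a => (sum_quadWeight (by omega) a).le)
  rw [← expect_sum_sq_eq] at h
  simpa only [Fintype.sum_prod_type] using h

/-! ### A central limit theorem for completely randomized assignments -/

/-- The indicator of arm `z`. -/
def ind (z : Fin 2) (Z : Fin n → Fin 2) (i : Fin n) : ℝ := if Z i = z then 1 else 0

lemma ind_eq_dev_add (z : Fin 2) (k : ℕ) (Z : Fin n → Fin 2) (i : Fin n) :
    ind z Z i = dev z k Z i + (k : ℝ) / n := by
  simp [ind, dev]

lemma ind_sq (z : Fin 2) (Z : Fin n → Fin 2) (i : Fin n) : ind z Z i ^ 2 = ind z Z i := by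
  unfold ind; split_ifs <;> simp

lemma ind_nonneg (z : Fin 2) (Z : Fin n → Fin 2) (i : Fin n) : 0 ≤ ind z Z i := by
  unfold ind; split_ifs <;> simp

lemma ind_le_one (z : Fin 2) (Z : Fin n → Fin 2) (i : Fin n) : ind z Z i ≤ 1 := by
  unfold ind; split_ifs <;> simp

lemma sum_ind {z : Fin 2} {k : ℕ} {Z : Fin n → Fin 2} (hZ : Z ∈ assignments n z k) :
    ∑ i, ind z Z i = k := by
  rw [← mem_assignments.1 hZ, armSize_eq_sum]
  rfl

lemma sum_mul_dev {z : Fin 2} {k : ℕ} {a : Fin n → ℝ} (ha : ∑ i, a i = 0) (Z : Fin n → Fin 2) :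
    ∑ i, a i * dev z k Z i = ∑ i, a i * ind z Z i := by
  simp only [ind_eq_dev_add z k, mul_add, Finset.sum_add_distrib]
  rw [← Finset.sum_mul, ha]
  simp

lemma sum_mul_ind_comp_swap {z : Fin 2} {a : Fin n → ℝ} {Z : Fin n → Fin 2} {i j : Fin n}
    (hi : Z i = z) (hj : Z j ≠ z) :
    ∑ l, a l * ind z (Z ∘ Equiv.swap i j) l = ∑ l, a l * ind z Z l + (a j - a i) := by
  have hij : i ≠ j := fun h => hj (h ▸ hi)
  have h1 : ∑ l, a l * ind z (Z ∘ Equiv.swap i j) l = ∑ l, a (Equiv.swap i j l) * ind z Z l := by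
    rw [← Equiv.sum_comp (Equiv.swap i j)]
    simp [ind]
  have h2 : ∑ l, (a (Equiv.swap i j l) - a l) * ind z Z l = a j - a i := by
    rw [Finset.sum_eq_single i]
    · simp [ind, hi]
    · intro l _ hl
      by_cases hlj : l = j
      · subst hlj; simp [ind, hj]
      · simp [Equiv.swap_apply_of_ne_of_ne hl hlj]
    · simp
  rw [h1, ← h2, ← Finset.sum_add_distrib]
  exact Finset.sum_congr rfl fun l _ => by ring

/-- The exchangeable pair identity for swapping a unit in arm `z` with one outside it. -/
lemma expect_exchange {z : Fin 2} {k : ℕ} (a : Fin n → ℝ) (g : ℝ → ℂ) :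
    𝔼 Z ∈ assignments n z k, ∑ i, ∑ j, ((ind z Z i * (1 - ind z Z j) * (a j - a i) : ℝ) : ℂ)
        * g (∑ l, a l * ind z Z l + (a j - a i))
      = - 𝔼 Z ∈ assignments n z k, ∑ i, ∑ j, ((ind z Z i * (1 - ind z Z j) * (a j - a i) : ℝ) : ℂ)
        * g (∑ l, a l * ind z Z l) := by
  have h1 : ∀ i j : Fin n, 𝔼 Z ∈ assignments n z k,
      ((ind z Z i * (1 - ind z Z j) * (a j - a i) : ℝ) : ℂ)
        * g (∑ l, a l * ind z Z l + (a j - a i))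
      = - 𝔼 Z ∈ assignments n z k, ((ind z Z j * (1 - ind z Z i) * (a i - a j) : ℝ) : ℂ)
        * g (∑ l, a l * ind z Z l) := by
    intro i j
    rw [← expect_comp_perm (Equiv.swap i j) (fun Z =>
      ((ind z Z j * (1 - ind z Z i) * (a i - a j) : ℝ) : ℂ) * g (∑ l, a l * ind z Z l)),
      ← Finset.expect_neg_distrib]
    refine Finset.expect_congr rfl fun Z _ => ?_
    have e1 : ind z (Z ∘ Equiv.swap i j) j = ind z Z i := by simp [ind]
    have e2 : ind z (Z ∘ Equiv.swap i j) i = ind z Z j := by simp [ind]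
    rw [e1, e2]
    -- The prefactor vanishes unless `i` is in the arm and `j` is outside it, which is exactly when
    -- the swap formula applies.
    by_cases hi : Z i = z
    · by_cases hj : Z j = z
      · simp [ind, hj]
      · rw [sum_mul_ind_comp_swap hi hj]
        push_cast
        ring
    · simp [ind, hi]
  simp only [Finset.expect_sum_comm, h1, Finset.sum_neg_distrib]
  rw [Finset.sum_comm]

/-- The linear regression property of the exchangeable pair: the total change of the statistic over
all admissible swaps is proportional to the statistic. -/
lemma sum_ind_mul_sub {z : Fin 2} {k : ℕ} {a : Fin n → ℝ} (ha : ∑ i, a i = 0)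
    {Z : Fin n → Fin 2} (hZ : Z ∈ assignments n z k) :
    ∑ i, ∑ j, ind z Z i * (1 - ind z Z j) * (a j - a i) = - (n * ∑ l, a l * ind z Z l) := by
  have h : ∀ i, ∑ j, ind z Z i * (1 - ind z Z j) * (a j - a i)
      = ind z Z i * (∑ j, a j - ∑ j, a j * ind z Z j) - a i * ind z Z i * (n - ∑ j, ind z Z j) := by
    intro i
    have hc : (n : ℝ) = ∑ _j : Fin n, (1 : ℝ) := by simp
    rw [hc, ← Finset.sum_sub_distrib, ← Finset.sum_sub_distrib, Finset.mul_sum, Finset.mul_sum,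
      ← Finset.sum_sub_distrib]
    exact Finset.sum_congr rfl fun j _ => by ring
  simp only [h, Finset.sum_sub_distrib, ← Finset.sum_mul, ha, sum_ind hZ]
  ring

/-- The conditional second moment of the exchangeable pair. The middle term is deterministic and
dominates; the first is a centred linear form in the squares, and the last is of lower order after
division by n. -/
lemma sum_ind_mul_sub_sq {z : Fin 2} {k : ℕ} {a : Fin n → ℝ} (ha : ∑ i, a i = 0)
    {Z : Fin n → Fin 2} (hZ : Z ∈ assignments n z k) (hn : 0 < n) :
    ∑ i, ∑ j, ind z Z i * (1 - ind z Z j) * (a j - a i) ^ 2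
      = (n - 2 * k) * ∑ i, a i ^ 2 * dev z k Z i + 2 * n * ((k : ℝ) / n * (1 - k / n)) * ∑ i, a i ^ 2
        + 2 * (∑ l, a l * ind z Z l) ^ 2 := by
  have hn' : (n : ℝ) ≠ 0 := by positivity
  have h : ∀ i, ∑ j, ind z Z i * (1 - ind z Z j) * (a j - a i) ^ 2
      = ind z Z i * (∑ j, a j ^ 2 - ∑ j, a j ^ 2 * ind z Z j)
        - 2 * (a i * ind z Z i) * (∑ j, a j - ∑ j, a j * ind z Z j)
        + a i ^ 2 * ind z Z i * (n - ∑ j, ind z Z j) := by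
    intro i
    have hc : (n : ℝ) = ∑ _j : Fin n, (1 : ℝ) := by simp
    rw [hc, ← Finset.sum_sub_distrib, ← Finset.sum_sub_distrib, ← Finset.sum_sub_distrib,
      Finset.mul_sum, Finset.mul_sum, Finset.mul_sum, ← Finset.sum_sub_distrib,
      ← Finset.sum_add_distrib]
    exact Finset.sum_congr rfl fun j _ => by ring
  have h2 : ∑ i, a i ^ 2 * ind z Z i = ∑ i, a i ^ 2 * dev z k Z i + k / n * ∑ i, a i ^ 2 := by
    simp only [ind_eq_dev_add z k, mul_add, Finset.sum_add_distrib, ← Finset.sum_mul]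
    ring
  simp only [h, Finset.sum_add_distrib, Finset.sum_sub_distrib, ← Finset.sum_mul, ← Finset.mul_sum,
    ha, sum_ind hZ, h2]
  field_simp
  ring

/-- Mean value inequality: on the segment from 0 to `x` the derivative has norm |exp(iy) - 1| ≤ |y|
≤ |x|. The sharp constant 1/2 is not needed. -/
lemma norm_exp_mul_I_sub_one_sub_le (x : ℝ) :
    ‖Complex.exp (x * Complex.I) - 1 - x * Complex.I‖ ≤ x ^ 2 := by
  have hd : ∀ y ∈ Set.uIcc 0 x, HasDerivWithinAt
      (fun y : ℝ => Complex.exp (y * Complex.I) - 1 - y * Complex.I)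
      (Complex.exp (y * Complex.I) * Complex.I - Complex.I) (Set.uIcc 0 x) y := by
    intro y _
    have h0 : HasDerivAt (fun y : ℝ => (y : ℂ) * Complex.I) Complex.I y := by
      simpa using (Complex.ofRealCLM.hasDerivAt (x := y)).mul_const Complex.I
    exact ((h0.cexp.sub_const 1).sub h0).hasDerivWithinAt
  have hb : ∀ y ∈ Set.uIcc 0 x, ‖Complex.exp (y * Complex.I) * Complex.I - Complex.I‖ ≤ |x| := by
    intro y hy
    have h1 : Complex.exp (y * Complex.I) * Complex.I - Complex.I
        = (Complex.exp (Complex.I * y) - 1) * Complex.I := by rw [mul_comm Complex.I]; ring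
    rw [h1, norm_mul, Complex.norm_I, mul_one]
    refine Real.norm_exp_I_mul_ofReal_sub_one_le.trans ?_
    simpa using Set.abs_sub_left_of_mem_uIcc hy
  have h := (convex_uIcc 0 x).norm_image_sub_le_of_norm_hasDerivWithin_le hd hb
    Set.left_mem_uIcc Set.right_mem_uIcc
  simp only [Complex.ofReal_zero, zero_mul, Complex.exp_zero, sub_self, sub_zero,
    Real.norm_eq_abs] at h
  rwa [← sq, sq_abs] at h

lemma expect_abs_le_sqrt {α : Type*} {s : Finset α} {f : α → ℝ} {c : ℝ}
    (h : 𝔼 a ∈ s, f a ^ 2 ≤ c) : 𝔼 a ∈ s, |f a| ≤ √c := by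
  refine Real.le_sqrt_of_sq_le (le_trans ?_ h)
  have := Finset.expect_mul_sq_le_sq_mul_sq s (fun a => |f a|) (fun _ => 1)
  simp only [mul_one, sq_abs, one_pow] at this
  rcases s.eq_empty_or_nonempty with rfl | hs
  · simp
  · rwa [Finset.expect_const hs, mul_one] at this

lemma norm_expect_le {α : Type*} (s : Finset α) (f : α → ℂ) :
    ‖𝔼 a ∈ s, f a‖ ≤ 𝔼 a ∈ s, ‖f a‖ := by
  rw [Finset.expect_eq_sum_div_card, Finset.expect_eq_sum_div_card, norm_div]
  simp only [RCLike.norm_natCast]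
  gcongr
  exact norm_sum_le _ _

/-- The characteristic function of `∑ aᵢ 1{Zᵢ = z}` approximately satisfies the differential
equation of the Gaussian characteristic function. -/
lemma norm_expect_mul_cexp_sub_le {z : Fin 2} {k : ℕ} (hk : k ≤ n) (hn : 2 ≤ n) {a : Fin n → ℝ}
    (ha : ∑ i, a i = 0) (hv : (k : ℝ) / n * (1 - k / n) * ∑ i, a i ^ 2 = 1 - 1 / n) {δ η : ℝ}
    (hδ : ∀ i, |a i| ≤ δ) (hδ0 : 0 ≤ δ)
    (hη : δ * √(3 * ∑ i, a i ^ 2) + (1 + 3 * ∑ i, a i ^ 2) / n ≤ η) (t : ℝ) :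
    ‖𝔼 Z ∈ assignments n z k, ((∑ l, a l * ind z Z l : ℝ) : ℂ)
          * Complex.exp ((t * ∑ l, a l * ind z Z l : ℝ) * Complex.I)
        - t * Complex.I * 𝔼 Z ∈ assignments n z k,
          Complex.exp ((t * ∑ l, a l * ind z Z l : ℝ) * Complex.I)‖
      ≤ |t| * η + 2 * t ^ 2 * δ * (1 + η) := by
  have hnp : 0 < n := by omega
  have hnR : (0 : ℝ) < n := by positivity
  set S := assignments n z k with hS
  have hSne : S.Nonempty := assignments_nonempty hk
  set w : (Fin n → Fin 2) → ℝ := fun Z => ∑ l, a l * ind z Z l with hw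
  set U : (Fin n → Fin 2) → ℝ := fun Z =>
    ∑ i, ∑ j, ind z Z i * (1 - ind z Z j) * (a j - a i) ^ 2 with hU
  set g : ℝ → ℂ := fun x => Complex.exp ((t * x : ℝ) * Complex.I) with hg
  have hg1 : ∀ x, ‖g x‖ = 1 := fun x => Complex.norm_exp_ofReal_mul_I _
  set A := ∑ i, a i ^ 2 with hA
  have hA0 : 0 ≤ A := by positivity
  -- the deviation of the conditional variance of the exchangeable pair from its mean
  have hUdev : 𝔼 Z ∈ S, |U Z / (2 * n) - 1| ≤ η := by
    have h1 : ∀ Z ∈ S, |U Z / (2 * n) - 1|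
        ≤ |∑ i, a i ^ 2 * dev z k Z i| + (1 + w Z ^ 2) / n := by
      intro Z hZ
      have e : U Z / (2 * n) - 1
          = (1 / 2 - k / n) * (∑ i, a i ^ 2 * dev z k Z i) + (w Z ^ 2 - 1) / n := by
        have h2 : U Z = (n - 2 * k) * ∑ i, a i ^ 2 * dev z k Z i + 2 * n * (1 - 1 / n)
            + 2 * w Z ^ 2 := by
          rw [hU, ← hv, ← mul_assoc (2 * (n : ℝ))]
          exact sum_ind_mul_sub_sq ha hZ hnp
        rw [h2]
        field_simp
        ring
      have hr0 : 0 ≤ (k : ℝ) / n := by positivity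
      have hr1 : (k : ℝ) / n ≤ 1 := div_le_one_of_le₀ (by exact_mod_cast hk) hnR.le
      rw [e]
      refine (abs_add_le _ _).trans (add_le_add ?_ ?_)
      · rw [abs_mul]
        refine mul_le_of_le_one_left (abs_nonneg _) ?_
        rw [abs_le]; constructor <;> linarith
      · rw [abs_div, abs_of_pos hnR]
        gcongr
        rw [abs_le]; constructor <;> nlinarith [sq_nonneg (w Z)]
    refine (Finset.expect_le_expect h1).trans (le_trans ?_ hη)
    rw [Finset.expect_add_distrib, ← Finset.expect_div, Finset.expect_add_distrib,
      Finset.expect_const hSne]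
    have h3 : 𝔼 Z ∈ S, w Z ^ 2 ≤ 3 * A := by
      simp only [hw, ← sum_mul_dev (z := z) (k := k) ha]
      exact expect_linear_sq_le hk hn a
    have h4 : 𝔼 Z ∈ S, |∑ i, a i ^ 2 * dev z k Z i| ≤ δ * √(3 * A) := by
      refine (expect_abs_le_sqrt (expect_linear_sq_le hk hn fun i => a i ^ 2)).trans ?_
      rw [← Real.sqrt_sq hδ0, ← Real.sqrt_mul (sq_nonneg δ)]
      refine Real.sqrt_le_sqrt ?_
      have : ∑ i, (a i ^ 2) ^ 2 ≤ δ ^ 2 * A := by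
        rw [hA, Finset.mul_sum]
        refine Finset.sum_le_sum fun i _ => ?_
        have := sq_le_sq' (by linarith [abs_nonneg (a i), hδ i]) (hδ i)
        rw [sq_abs] at this
        nlinarith [sq_nonneg (a i)]
      linarith
    gcongr
  have hη0 : 0 ≤ η := (Finset.expect_nonneg fun _ _ => abs_nonneg _).trans hUdev
  have hUmean : 𝔼 Z ∈ S, U Z / (2 * n) ≤ 1 + η := by
    have : 𝔼 Z ∈ S, U Z / (2 * n) ≤ 𝔼 Z ∈ S, (1 + |U Z / (2 * n) - 1|) :=
      Finset.expect_le_expect fun Z _ => by linarith [le_abs_self (U Z / (2 * n) - 1)]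
    rw [Finset.expect_add_distrib, Finset.expect_const hSne] at this
    linarith
  -- Taylor expansion in the exchange identity
  set R : (Fin n → Fin 2) → ℂ := fun Z => ∑ i, ∑ j,
    ((ind z Z i * (1 - ind z Z j) * (a j - a i) : ℝ) : ℂ)
      * (g (w Z + (a j - a i)) - g (w Z) - ((t * (a j - a i) : ℝ) * Complex.I) * g (w Z)) with hR
  have hRb : ∀ Z, ‖R Z‖ ≤ 2 * n * (2 * t ^ 2 * δ) * (U Z / (2 * n)) := by
    intro Z
    have e : 2 * n * (2 * t ^ 2 * δ) * (U Z / (2 * n)) = 2 * t ^ 2 * δ * U Z := by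
      field_simp
    rw [e, hU, Finset.mul_sum]
    refine (norm_sum_le _ _).trans (Finset.sum_le_sum fun i _ => ?_)
    rw [Finset.mul_sum]
    refine (norm_sum_le _ _).trans (Finset.sum_le_sum fun j _ => ?_)
    have h0 : 0 ≤ ind z Z i * (1 - ind z Z j) :=
      mul_nonneg (ind_nonneg _ _ _) (sub_nonneg.2 (ind_le_one _ _ _))
    have h1 : g (w Z + (a j - a i)) - g (w Z) - ((t * (a j - a i) : ℝ) * Complex.I) * g (w Z)
        = (Complex.exp ((t * (a j - a i) : ℝ) * Complex.I) - 1
          - (t * (a j - a i) : ℝ) * Complex.I) * g (w Z) := by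
      have : g (w Z + (a j - a i)) = Complex.exp ((t * (a j - a i) : ℝ) * Complex.I) * g (w Z) := by
        simp only [hg]
        rw [← Complex.exp_add]
        congr 1
        push_cast
        ring
      rw [this]
      ring
    have h2 := norm_exp_mul_I_sub_one_sub_le (t * (a j - a i))
    have h3 : |a j - a i| ≤ 2 * δ := by
      have := abs_sub (a j) (a i)
      linarith [hδ i, hδ j]
    rw [h1, norm_mul, norm_mul, hg1, mul_one, Complex.norm_real, Real.norm_eq_abs, abs_mul,
      abs_of_nonneg h0]
    calc _ ≤ ind z Z i * (1 - ind z Z j) * (2 * δ) * (t * (a j - a i)) ^ 2 := by gcongr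
      _ = _ := by ring
  -- The exchange identity says that the weighted sum of g(W') + g(W) has mean zero. Expanding g(W')
  -- to first order, the term -n W g(W) appears twice and the quadratic sum gives i t U g(W), whence
  -- the factor 2n on both sides.
  have hexch : 2 * n * (𝔼 Z ∈ S, (w Z : ℂ) * g (w Z) - t * Complex.I * 𝔼 Z ∈ S, g (w Z))
      = 2 * n * (t * Complex.I * 𝔼 Z ∈ S, ((U Z / (2 * n) - 1 : ℝ) : ℂ) * g (w Z))
        + 𝔼 Z ∈ S, R Z := by
    have h := expect_exchange (z := z) (k := k) a g
    have hlin : ∀ Z ∈ S, ∑ i, ∑ j, ((ind z Z i * (1 - ind z Z j) * (a j - a i) : ℝ) : ℂ) * g (w Z)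
        = - (n * (w Z * g (w Z))) := by
      intro Z hZ
      simp only [← Finset.sum_mul]
      have := congrArg (fun x : ℝ => (x : ℂ)) (sum_ind_mul_sub ha hZ)
      simp only [Complex.ofReal_sum] at this
      rw [this]
      push_cast
      simp only [hw]
      push_cast
      ring
    have hRe : ∀ Z ∈ S, R Z = ∑ i, ∑ j, ((ind z Z i * (1 - ind z Z j) * (a j - a i) : ℝ) : ℂ)
          * g (w Z + (a j - a i)) + n * (w Z * g (w Z)) - t * Complex.I * (U Z * g (w Z)) := by
      intro Z hZ
      rw [← neg_neg ((n : ℂ) * (w Z * g (w Z))), ← hlin Z hZ, ← sub_eq_add_neg]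
      simp only [hU, hR, Complex.ofReal_sum, Finset.mul_sum, Finset.sum_mul,
        ← Finset.sum_sub_distrib]
      refine Finset.sum_congr rfl fun i _ => Finset.sum_congr rfl fun j _ => ?_
      push_cast
      ring
    rw [Finset.expect_congr rfl hlin, Finset.expect_neg_distrib, neg_neg] at h
    rw [Finset.expect_congr rfl hRe, Finset.expect_sub_distrib, Finset.expect_add_distrib, h]
    simp only [← Finset.mul_expect]
    have e2 : 𝔼 Z ∈ S, ((U Z / (2 * n) - 1 : ℝ) : ℂ) * g (w Z)
        = (1 / (2 * n) : ℂ) * 𝔼 Z ∈ S, (U Z * g (w Z)) - 𝔼 Z ∈ S, g (w Z) := by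
      rw [Finset.mul_expect, ← Finset.expect_sub_distrib]
      refine Finset.expect_congr rfl fun Z _ => ?_
      push_cast
      ring
    rw [e2]
    have hnC : (n : ℂ) ≠ 0 := by exact_mod_cast hnp.ne'
    field_simp
    ring
  have hnorm : 2 * n * ‖𝔼 Z ∈ S, (w Z : ℂ) * g (w Z) - t * Complex.I * 𝔼 Z ∈ S, g (w Z)‖
      ≤ 2 * n * (|t| * η) + 2 * n * (2 * t ^ 2 * δ) * (1 + η) := by
    have h0 : ‖(2 * n : ℂ)‖ = 2 * n := by simp
    rw [← h0, ← norm_mul, hexch]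
    refine (norm_add_le _ _).trans (add_le_add ?_ ?_)
    · rw [norm_mul, norm_mul ((t : ℂ) * Complex.I), norm_mul (t : ℂ), Complex.norm_I, Complex.norm_real, Real.norm_eq_abs, mul_one]
      gcongr
      refine (norm_expect_le _ _).trans (le_trans (le_of_eq ?_) hUdev)
      refine Finset.expect_congr rfl fun Z _ => ?_
      rw [norm_mul, hg1, mul_one, Complex.norm_real, Real.norm_eq_abs]
    · refine (norm_expect_le _ _).trans ((Finset.expect_le_expect fun Z _ => hRb Z).trans ?_)
      rw [← Finset.mul_expect, h0]
      gcongr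
  have : 2 * n * (|t| * η) + 2 * n * (2 * t ^ 2 * δ) * (1 + η)
      = 2 * n * (|t| * η + 2 * t ^ 2 * δ * (1 + η)) := by ring
  rw [this] at hnorm
  exact le_of_mul_le_mul_left hnorm (by positivity)

/-- A quantitative central limit theorem, in terms of characteristic functions. -/
lemma norm_expect_cexp_sub_le {z : Fin 2} {k : ℕ} (hk : k ≤ n) (hn : 2 ≤ n) {a : Fin n → ℝ}
    (ha : ∑ i, a i = 0) (hv : (k : ℝ) / n * (1 - k / n) * ∑ i, a i ^ 2 = 1 - 1 / n) {δ η : ℝ}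
    (hδ : ∀ i, |a i| ≤ δ) (hδ0 : 0 ≤ δ)
    (hη : δ * √(3 * ∑ i, a i ^ 2) + (1 + 3 * ∑ i, a i ^ 2) / n ≤ η) (t : ℝ) :
    ‖𝔼 Z ∈ assignments n z k, Complex.exp ((t * ∑ l, a l * ind z Z l : ℝ) * Complex.I)
        - Complex.exp (-(t ^ 2 / 2 : ℝ))‖
      ≤ |t| * (|t| * η + 2 * t ^ 2 * δ * (1 + η)) := by
  set w : (Fin n → Fin 2) → ℝ := fun Z => ∑ l, a l * ind z Z l with hw
  set S := assignments n z k
  have hSne : S.Nonempty := assignments_nonempty hk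
  have hη0 : 0 ≤ η := le_trans (by positivity) hη
  have hφ : ∀ x : ℝ, HasDerivAt (fun x : ℝ => 𝔼 Z ∈ S, Complex.exp ((x * w Z : ℝ) * Complex.I))
      (Complex.I * 𝔼 Z ∈ S, (w Z : ℂ) * Complex.exp ((x * w Z : ℝ) * Complex.I)) x := by
    intro x
    simp only [Finset.expect_eq_sum_div_card, ← mul_div_assoc, Finset.mul_sum]
    refine (HasDerivAt.fun_sum fun Z _ => ?_).div_const _
    have h0 : HasDerivAt (fun y : ℝ => ((y * w Z : ℝ) : ℂ) * Complex.I) (w Z * Complex.I) x := by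
      have := ((Complex.ofRealCLM.hasDerivAt (x := x)).mul_const (w Z : ℂ)).mul_const Complex.I
      simpa using this
    exact h0.cexp.congr_deriv (by ring)
  -- Multiplying by the integrating factor exp(x²/2) leaves only the defect of the Gaussian
  -- differential equation in the derivative.
  have hψ : ∀ x ∈ Set.uIcc 0 t, HasDerivWithinAt (fun x : ℝ =>
      (𝔼 Z ∈ S, Complex.exp ((x * w Z : ℝ) * Complex.I)) * Complex.exp ((x ^ 2 / 2 : ℝ)))
      (Complex.I * (𝔼 Z ∈ S, (w Z : ℂ) * Complex.exp ((x * w Z : ℝ) * Complex.I)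
        - x * Complex.I * 𝔼 Z ∈ S, Complex.exp ((x * w Z : ℝ) * Complex.I))
        * Complex.exp ((x ^ 2 / 2 : ℝ))) (Set.uIcc 0 t) x := by
    intro x _
    have h1 : HasDerivAt (fun x : ℝ => Complex.exp ((x ^ 2 / 2 : ℝ)))
        (Complex.exp ((x ^ 2 / 2 : ℝ)) * x) x := by
      have : HasDerivAt (fun x : ℝ => ((x ^ 2 / 2 : ℝ) : ℂ)) ((x : ℝ) : ℂ) x := by
        have h2 : HasDerivAt (fun x : ℝ => x ^ 2 / 2) x x := by
          exact (((hasDerivAt_id x).pow 2).div_const 2).congr_deriv (by simp)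
        exact h2.ofReal_comp
      exact this.cexp
    refine (((hφ x).mul h1).congr_deriv ?_).hasDerivWithinAt
    linear_combination (x * (𝔼 Z ∈ S, Complex.exp ((x * w Z : ℝ) * Complex.I))
      * Complex.exp ((x ^ 2 / 2 : ℝ))) * Complex.I_mul_I
  set E := |t| * η + 2 * t ^ 2 * δ * (1 + η) with hE
  have hb : ∀ x ∈ Set.uIcc 0 t, ‖Complex.I * (𝔼 Z ∈ S, (w Z : ℂ)
        * Complex.exp ((x * w Z : ℝ) * Complex.I)
        - x * Complex.I * 𝔼 Z ∈ S, Complex.exp ((x * w Z : ℝ) * Complex.I))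
        * Complex.exp ((x ^ 2 / 2 : ℝ))‖ ≤ E * Real.exp (t ^ 2 / 2) := by
    intro x hx
    have hxt : |x| ≤ |t| := by simpa using Set.abs_sub_left_of_mem_uIcc hx
    have hxt2 : x ^ 2 ≤ t ^ 2 := sq_le_sq.2 hxt
    rw [norm_mul, norm_mul, Complex.norm_I, one_mul, Complex.norm_exp_ofReal]
    have h1 := norm_expect_mul_cexp_sub_le (z := z) hk hn ha hv hδ hδ0 hη x
    have h2 : |x| * η + 2 * x ^ 2 * δ * (1 + η) ≤ E := by rw [hE]; gcongr
    gcongr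
    exact h1.trans h2
  have h := (convex_uIcc 0 t).norm_image_sub_le_of_norm_hasDerivWithin_le hψ hb
    Set.left_mem_uIcc Set.right_mem_uIcc
  have h0 : (𝔼 Z ∈ S, Complex.exp (((0 : ℝ) * w Z : ℝ) * Complex.I))
      * Complex.exp (((0 : ℝ) ^ 2 / 2 : ℝ)) = 1 := by
    simp [Finset.expect_const hSne]
  rw [h0, sub_zero, Real.norm_eq_abs] at h
  have hexp : Complex.exp ((t ^ 2 / 2 : ℝ)) * Complex.exp (-(t ^ 2 / 2 : ℝ)) = 1 := by
    rw [← Complex.exp_add]; simp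
  have e : 𝔼 Z ∈ S, Complex.exp ((t * w Z : ℝ) * Complex.I) - Complex.exp (-(t ^ 2 / 2 : ℝ))
      = ((𝔼 Z ∈ S, Complex.exp ((t * w Z : ℝ) * Complex.I)) * Complex.exp ((t ^ 2 / 2 : ℝ)) - 1)
        * Complex.exp (-(t ^ 2 / 2 : ℝ)) := by
    rw [sub_mul, mul_assoc, hexp]
    ring
  rw [e, norm_mul, ← Complex.ofReal_neg, Complex.norm_exp_ofReal]
  -- The factor exp(t²/2) lost in the derivative bound is recovered on dividing by the integrating
  -- factor.
  calc _ ≤ E * Real.exp (t ^ 2 / 2) * |t| * Real.exp (-(t ^ 2 / 2)) := by gcongr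
    _ = |t| * E * (Real.exp (t ^ 2 / 2) * Real.exp (-(t ^ 2 / 2))) := by ring
    _ = |t| * E := by rw [← Real.exp_add]; simp

variable {p : ℕ}

/-! ### The hat matrix -/

lemma sum_sub_mean (a : Fin n → ℝ) : ∑ i, (a i - mean a) = 0 := by
  rcases Nat.eq_zero_or_pos n with rfl | hn
  · simp
  · have : (n : ℝ) ≠ 0 := by positivity
    rw [Finset.sum_sub_distrib, Finset.sum_const, Finset.card_univ, Fintype.card_fin, nsmul_eq_mul,
      mean, mul_div_cancel₀ _ this, sub_self]

lemma sum_centered (X : Matrix (Fin n) (Fin p) ℝ) (j : Fin p) : ∑ i, centered X i j = 0 :=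
  sum_sub_mean fun i => X i j

/-- The matrix whose rows are the centred covariates. -/
def centeredMatrix (X : Matrix (Fin n) (Fin p) ℝ) : Matrix (Fin n) (Fin p) ℝ :=
  Matrix.of (centered X)

lemma covMatrix_eq (X : Matrix (Fin n) (Fin p) ℝ) :
    covMatrix X = ((n : ℝ) - 1)⁻¹ • ((centeredMatrix X)ᵀ * centeredMatrix X) := by
  ext j l
  simp [covMatrix, cov, centeredMatrix, centered, Matrix.mul_apply, div_eq_inv_mul]

lemma hat_eq (X : Matrix (Fin n) (Fin p) ℝ) :
    Matrix.of (hat X)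
      = ((n : ℝ) - 1)⁻¹ • (centeredMatrix X * (covMatrix X)⁻¹ * (centeredMatrix X)ᵀ) := by
  ext i j
  rw [Matrix.mul_assoc]
  simp [hat, centeredMatrix, Matrix.mul_apply, Matrix.mulVec, dotProduct]

lemma covMatrix_transpose (X : Matrix (Fin n) (Fin p) ℝ) : (covMatrix X)ᵀ = covMatrix X := by
  rw [covMatrix_eq, Matrix.transpose_smul, Matrix.transpose_mul, Matrix.transpose_transpose]

lemma hat_comm (X : Matrix (Fin n) (Fin p) ℝ) (i j : Fin n) : hat X i j = hat X j i := by
  have h : (Matrix.of (hat X))ᵀ = Matrix.of (hat X) := by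
    rw [hat_eq, Matrix.transpose_smul, Matrix.transpose_mul, Matrix.transpose_mul,
      Matrix.transpose_transpose, Matrix.transpose_nonsing_inv, covMatrix_transpose,
      Matrix.mul_assoc]
  exact congrFun (congrFun h j) i

lemma sum_hat_left (X : Matrix (Fin n) (Fin p) ℝ) (j : Fin n) : ∑ i, hat X i j = 0 := by
  simp only [hat, ← Finset.mul_sum, dotProduct]
  rw [Finset.sum_comm]
  simp [← Finset.sum_mul, sum_centered]

lemma sum_hat (X : Matrix (Fin n) (Fin p) ℝ) (i : Fin n) : ∑ j, hat X i j = 0 := by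
  rw [Finset.sum_congr rfl fun j _ => hat_comm X i j, sum_hat_left]

/-- The Gram matrix of the centred covariates is (n - 1) S_X², which cancels one of the two
inverses. With symmetry, H is an orthogonal projection. -/
lemma hat_mul_hat (hn : 2 ≤ n) {X : Matrix (Fin n) (Fin p) ℝ} (hX : IsUnit (covMatrix X).det)
    (i l : Fin n) : ∑ j, hat X i j * hat X j l = hat X i l := by
  have hn1 : ((n : ℝ) - 1) ≠ 0 := by
    have : (2 : ℝ) ≤ n := by exact_mod_cast hn
    linarith
  have hC : (centeredMatrix X)ᵀ * centeredMatrix X = ((n : ℝ) - 1) • covMatrix X := by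
    rw [covMatrix_eq, smul_smul, mul_inv_cancel₀ hn1, one_smul]
  have h : Matrix.of (hat X) * Matrix.of (hat X) = Matrix.of (hat X) := by
    rw [hat_eq, Matrix.smul_mul, Matrix.mul_smul, smul_smul]
    have : centeredMatrix X * (covMatrix X)⁻¹ * (centeredMatrix X)ᵀ
        * (centeredMatrix X * (covMatrix X)⁻¹ * (centeredMatrix X)ᵀ)
        = centeredMatrix X * (covMatrix X)⁻¹ * ((centeredMatrix X)ᵀ * centeredMatrix X)
          * ((covMatrix X)⁻¹ * (centeredMatrix X)ᵀ) := by
      simp only [Matrix.mul_assoc]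
    rw [this, hC, Matrix.mul_smul, Matrix.smul_mul, smul_smul, mul_assoc, inv_mul_cancel₀ hn1,
      mul_one, Matrix.mul_assoc (centeredMatrix X), Matrix.nonsing_inv_mul _ hX, Matrix.mul_one,
      ← Matrix.mul_assoc]
  have h2 := congrFun (congrFun h i) l
  simpa [Matrix.mul_apply] using h2

/-- By cyclicity the trace of H is that of the p × p identity. -/
lemma sum_hat_self (hn : 2 ≤ n) {X : Matrix (Fin n) (Fin p) ℝ} (hX : IsUnit (covMatrix X).det) :
    ∑ i, hat X i i = p := by
  have hn1 : ((n : ℝ) - 1) ≠ 0 := by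
    have : (2 : ℝ) ≤ n := by exact_mod_cast hn
    linarith
  have h : (Matrix.of (hat X)).trace = p := by
    rw [hat_eq, Matrix.trace_smul, Matrix.trace_mul_comm, ← Matrix.mul_assoc, ← Matrix.trace_smul,
      ← Matrix.smul_mul, ← covMatrix_eq, Matrix.mul_nonsing_inv _ hX, Matrix.trace_one,
      Fintype.card_fin]
  simpa [Matrix.trace] using h

lemma sum_hat_sq (hn : 2 ≤ n) {X : Matrix (Fin n) (Fin p) ℝ} (hX : IsUnit (covMatrix X).det)
    (i : Fin n) : ∑ j, hat X i j ^ 2 = hat X i i := by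
  rw [← hat_mul_hat hn hX i i]
  exact Finset.sum_congr rfl fun j _ => by rw [sq, hat_comm X j i]

lemma hat_self_nonneg (hn : 2 ≤ n) {X : Matrix (Fin n) (Fin p) ℝ} (hX : IsUnit (covMatrix X).det)
    (i : Fin n) : 0 ≤ hat X i i := by
  rw [← sum_hat_sq hn hX]
  positivity

lemma hat_self_le_one (hn : 2 ≤ n) {X : Matrix (Fin n) (Fin p) ℝ} (hX : IsUnit (covMatrix X).det)
    (i : Fin n) : hat X i i ≤ 1 := by
  have h1 : hat X i i ^ 2 ≤ hat X i i := by
    conv_rhs => rw [← sum_hat_sq hn hX]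
    exact Finset.single_le_sum (f := fun j => hat X i j ^ 2) (fun j _ => sq_nonneg _)
      (Finset.mem_univ i)
  nlinarith

/-- An orthogonal projection is a contraction: ‖Hy‖² = yᵀHy, and ‖y - Hy‖² ≥ 0. -/
lemma sum_sq_hat_mul_le (hn : 2 ≤ n) {X : Matrix (Fin n) (Fin p) ℝ}
    (hX : IsUnit (covMatrix X).det) (y : Fin n → ℝ) :
    ∑ i, (∑ j, hat X i j * y j) ^ 2 ≤ ∑ i, y i ^ 2 := by
  have h1 : ∑ i, (∑ j, hat X i j * y j) ^ 2 = ∑ j, y j * ∑ l, hat X j l * y l := by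
    have : ∀ i, (∑ j, hat X i j * y j) ^ 2 = ∑ j, ∑ l, y j * (hat X j i * hat X i l) * y l := by
      intro i
      rw [sq, Finset.sum_mul_sum]
      refine Finset.sum_congr rfl fun j _ => Finset.sum_congr rfl fun l _ => ?_
      rw [hat_comm X j i]
      ring
    simp only [this]
    rw [Finset.sum_comm]
    refine Finset.sum_congr rfl fun j _ => ?_
    rw [Finset.sum_comm, Finset.mul_sum]
    refine Finset.sum_congr rfl fun l _ => ?_
    rw [← Finset.sum_mul, ← Finset.mul_sum, hat_mul_hat hn hX]
    ring
  have h2 : 0 ≤ ∑ i, (y i - ∑ j, hat X i j * y j) ^ 2 := by positivity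
  have h3 : ∑ i, (y i - ∑ j, hat X i j * y j) ^ 2
      = ∑ i, y i ^ 2 - 2 * ∑ j, y j * ∑ l, hat X j l * y l + ∑ i, (∑ j, hat X i j * y j) ^ 2 := by
    rw [Finset.mul_sum, ← Finset.sum_sub_distrib, ← Finset.sum_add_distrib]
    exact Finset.sum_congr rfl fun i _ => by ring
  linarith

/-- `(S_X⁻² ∑ⱼ aⱼ (Xⱼ - X̄) / c)ᵀ (Xᵢ - X̄)` in terms of the hat matrix. -/
lemma inv_covMatrix_mulVec_dotProduct (hn : 2 ≤ n) (X : Matrix (Fin n) (Fin p) ℝ) (a : Fin n → ℝ)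
    (c : ℝ) (i : Fin n) :
    ((covMatrix X)⁻¹ *ᵥ fun j => (∑ l, centered X l j * a l) / c) ⬝ᵥ centered X i
      = ((n : ℝ) - 1) / c * ∑ j, hat X i j * a j := by
  have hn1 : ((n : ℝ) - 1) ≠ 0 := by
    have : (2 : ℝ) ≤ n := by exact_mod_cast hn
    linarith
  have h1 : (fun j => (∑ l, centered X l j * a l) / c) = c⁻¹ • ∑ l, a l • centered X l := by
    ext j
    simp only [Pi.smul_apply, Finset.sum_apply, smul_eq_mul, div_eq_inv_mul]
    congr 1
    exact Finset.sum_congr rfl fun l _ => mul_comm _ _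
  have h2 : ∀ l, ((covMatrix X)⁻¹ *ᵥ centered X l) ⬝ᵥ centered X i = (n - 1) * hat X i l := by
    intro l
    rw [hat, ← mul_assoc, mul_inv_cancel₀ hn1, one_mul, dotProduct_comm]
  rw [h1, Matrix.mulVec_smul, Matrix.mulVec_sum, smul_dotProduct, sum_dotProduct]
  simp only [Matrix.mulVec_smul, smul_dotProduct, h2, smul_eq_mul, Finset.mul_sum]
  refine Finset.sum_congr rfl fun l _ => ?_
  field_simp

lemma resid_eq (hn : 2 ≤ n) (X : Matrix (Fin n) (Fin p) ℝ) (y : Fin n → ℝ) (i : Fin n) :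
    resid X y i = (y i - mean y) - ∑ j, hat X i j * (y j - mean y) := by
  have hn1 : ((n : ℝ) - 1) ≠ 0 := by
    have : (2 : ℝ) ≤ n := by exact_mod_cast hn
    linarith
  have h := inv_covMatrix_mulVec_dotProduct hn X (fun j => y j - mean y) ((n : ℝ) - 1) i
  rw [div_self hn1, one_mul] at h
  rw [resid, popBeta, ← h]
  rfl

lemma sum_resid (hn : 2 ≤ n) (X : Matrix (Fin n) (Fin p) ℝ) (y : Fin n → ℝ) :
    ∑ i, resid X y i = 0 := by
  simp only [resid_eq hn, Finset.sum_sub_distrib (f := fun i => y i - mean y), sum_sub_mean]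
  rw [Finset.sum_comm]
  simp [← Finset.sum_mul, sum_hat_left]

/-- A weighted sum with weights in `[0, 1]` of total mass `k` is at most the sum of the `k`
largest entries. -/
lemma sum_mul_le_sumLargest {k : ℕ} {w f : Fin n → ℝ} (hw0 : ∀ i, 0 ≤ w i) (hw1 : ∀ i, w i ≤ 1)
    (hw : ∑ i, w i = k) (hk : k < n) : ∑ i, w i * f i ≤ sumLargest k f := by
  set σ := Tuple.sort (fun j => OrderDual.toDual (f j)) with hσ
  have hmono : ∀ i j : Fin n, i ≤ j → f (σ j) ≤ f (σ i) := fun i j hij =>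
    Tuple.monotone_sort (fun j => OrderDual.toDual (f j)) hij
  -- The (k + 1)-th largest entry, which exists because k < n. It separates the entries counted in
  -- `sumLargest` from the rest; as both weightings have mass `k`, comparing every entry with `t`
  -- costs nothing in total.
  set t := f (σ ⟨k, hk⟩)
  have h1 : ∑ i, w i * f i = ∑ i, w (σ i) * f (σ i) :=
    (Equiv.sum_comp σ fun i => w i * f i).symm
  have h2 : sumLargest k f = ∑ i : Fin n, if i.val < k then f (σ i) else 0 := by
    rw [sumLargest, Finset.sum_filter]
  have h3 : ∑ i : Fin n, (w (σ i) - if i.val < k then 1 else 0) = 0 := by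
    rw [Finset.sum_sub_distrib, Equiv.sum_comp σ w, hw]
    simp only [Finset.sum_boole]
    rw [Fin.card_filter_val_lt, min_eq_right hk.le, sub_self]
  have h4 : ∀ i : Fin n, w (σ i) * f (σ i) - (if i.val < k then f (σ i) else 0)
      ≤ (w (σ i) - if i.val < k then 1 else 0) * t := by
    intro i
    split_ifs with hi
    · have : t ≤ f (σ i) := hmono i ⟨k, hk⟩ hi.le
      nlinarith [hw1 (σ i)]
    · have : f (σ i) ≤ t := hmono ⟨k, hk⟩ i (not_lt.1 hi)
      nlinarith [hw0 (σ i)]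
  have h5 := Finset.sum_le_sum fun i (_ : i ∈ Finset.univ) => h4 i
  rw [← Finset.sum_mul, h3, zero_mul, Finset.sum_sub_distrib, ← h1, ← h2] at h5
  linarith

/-! ### Linearization of the debiased estimator in one arm -/

/-- The contribution of arm `z` to the debiased estimator, for outcomes `y`. -/
def armEst (X : Matrix (Fin n) (Fin p) ℝ) (Z : Fin n → Fin 2) (y : Fin n → ℝ) (z : Fin 2) : ℝ :=
  armMean Z (fun i => y i - betaHat X Z y z ⬝ᵥ centered X i) z
    + armProp Z z * (1 - armProp Z z)
      * armMean Z (fun i => hat X i i * ((y i - armMean Z y z) / armProp Z z ^ 2)) z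

lemma armMean_eq {z : Fin 2} {k : ℕ} {Z : Fin n → Fin 2} (hZ : Z ∈ assignments n z k)
    (a : Fin n → ℝ) : armMean Z a z = (∑ i, a i * ind z Z i) / k := by
  rw [armMean, mem_assignments.1 hZ, Finset.sum_filter]
  congr 1
  exact Finset.sum_congr rfl fun i _ => by simp [ind]

lemma armMean_eq_mean_add {z : Fin 2} {k : ℕ} (hk : 0 < k) {Z : Fin n → Fin 2}
    (hZ : Z ∈ assignments n z k) (y : Fin n → ℝ) :
    armMean Z y z = mean y + (∑ i, (y i - mean y) * dev z k Z i) / k := by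
  have hk' : (k : ℝ) ≠ 0 := by positivity
  rw [armMean_eq hZ, sum_mul_dev (sum_sub_mean y)]
  simp only [sub_mul, Finset.sum_sub_distrib, ← Finset.mul_sum, sum_ind hZ]
  field_simp
  ring

lemma betaHat_dotProduct (hn : 2 ≤ n) (X : Matrix (Fin n) (Fin p) ℝ) {z : Fin 2} {k : ℕ}
    {Z : Fin n → Fin 2} (hZ : Z ∈ assignments n z k) (y : Fin n → ℝ) (i : Fin n) :
    betaHat X Z y z ⬝ᵥ centered X i
      = ((n : ℝ) - 1) / (k - 1) * ∑ j, hat X i j * (ind z Z j * (y j - armMean Z y z)) := by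
  rw [← inv_covMatrix_mulVec_dotProduct hn X, betaHat]
  congr 2
  ext j
  rw [armCovVec, mem_assignments.1 hZ, Finset.sum_filter]
  congr 1
  exact Finset.sum_congr rfl fun l _ => by simp [ind]

/-- The off-diagonal quadratic form in the centred indicators. -/
def offDiag (X : Matrix (Fin n) (Fin p) ℝ) (z : Fin 2) (k : ℕ) (y : Fin n → ℝ)
    (Z : Fin n → Fin 2) : ℝ :=
  ∑ i, ∑ j, (if i = j then 0 else hat X i j * y j) * (dev z k Z i * dev z k Z j)

/-- Every indicator is T + r, and Tᵢ² = (1 - 2r) Tᵢ + r(1 - r). The third term on the right is the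
source of the bias. -/
lemma sum_hat_ind (X : Matrix (Fin n) (Fin p) ℝ) (z : Fin 2) (k : ℕ) (y : Fin n → ℝ)
    (Z : Fin n → Fin 2) :
    ∑ i, ind z Z i * ∑ j, hat X i j * (ind z Z j * y j)
      = (k : ℝ) / n * ∑ i, (∑ j, hat X i j * y j) * dev z k Z i
        + (1 - 2 * ((k : ℝ) / n)) * ∑ i, hat X i i * y i * dev z k Z i
        + (k : ℝ) / n * (1 - k / n) * ∑ i, hat X i i * y i + offDiag X z k y Z := by
  set r : ℝ := (k : ℝ) / n with hr
  have hsq : ∀ i, dev z k Z i ^ 2 = (1 - 2 * r) * dev z k Z i + r * (1 - r) := by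
    intro i
    have h1 := ind_sq z Z i
    rw [ind_eq_dev_add z k, ← hr] at h1
    linear_combination h1
  -- The columns of H sum to zero, so the left indicator can be centred at no cost.
  have h1 : ∑ i, ind z Z i * ∑ j, hat X i j * (ind z Z j * y j)
      = ∑ i, dev z k Z i * ∑ j, hat X i j * (ind z Z j * y j) := by
    have h0 : ∑ i, r * ∑ j, hat X i j * (ind z Z j * y j) = 0 := by
      rw [← Finset.mul_sum, Finset.sum_comm]
      simp [← Finset.sum_mul, sum_hat_left]
    rw [← sub_eq_zero, ← Finset.sum_sub_distrib, ← h0]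
    refine Finset.sum_congr rfl fun i _ => ?_
    rw [ind_eq_dev_add z k Z i, ← hr]
    ring
  rw [h1, offDiag, Finset.mul_sum, Finset.mul_sum, Finset.mul_sum, ← Finset.sum_add_distrib,
    ← Finset.sum_add_distrib, ← Finset.sum_add_distrib]
  refine Finset.sum_congr rfl fun i _ => ?_
  have h2 : (1 - 2 * r) * (hat X i i * y i * dev z k Z i) + r * (1 - r) * (hat X i i * y i)
      = ∑ j, if i = j then hat X i j * y j * (dev z k Z i * dev z k Z j) else 0 := by
    rw [Finset.sum_ite_eq, if_pos (Finset.mem_univ i), ← sq, hsq]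
    ring
  rw [add_assoc (r * _), h2, Finset.sum_mul, Finset.mul_sum, Finset.mul_sum,
    ← Finset.sum_add_distrib, ← Finset.sum_add_distrib]
  refine Finset.sum_congr rfl fun j _ => ?_
  rw [ind_eq_dev_add z k Z j, ← hr]
  split_ifs <;> ring

/-- The bias enters with coefficient -c r(1 - r) from the regression and (1 - r)/k from the
debiasing; they cancel to -(1 - r)²/(k(k - 1)), smaller by an order of n. The last two terms come
from centring at the arm mean instead of the population mean. -/
lemma armEst_sub_eq (hn : 2 ≤ n) (X : Matrix (Fin n) (Fin p) ℝ) {z : Fin 2} {k : ℕ} (hk : 2 ≤ k)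
    {Z : Fin n → Fin 2} (hZ : Z ∈ assignments n z k) (Y : Fin n → ℝ) {r c : ℝ}
    (hr : r = (k : ℝ) / n) (hc : c = ((n : ℝ) - 1) / (k * (k - 1))) {y : Fin n → ℝ}
    (hy : y = fun i => Y i - mean Y) :
    armEst X Z Y z - mean Y - (∑ i, resid X Y i * ind z Z i) / k
      = - ((1 - r) / (k * (k - 1))) * ∑ i, (∑ j, hat X i j * y j) * dev z k Z i
        - (1 - r) ^ 2 / (k * (k - 1)) * ∑ i, hat X i i * y i
        + ((1 - r) / (r * k) - (1 - 2 * r) * c) * ∑ i, hat X i i * y i * dev z k Z i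
        - c * offDiag X z k y Z
        + c / k * ((∑ i, ind z Z i * ∑ j, hat X i j * (ind z Z j * 1))
          * ∑ i, y i * dev z k Z i)
        - (1 - r) / (r * k ^ 2) * ((∑ i, hat X i i * ind z Z i) * ∑ i, y i * dev z k Z i) := by
  have hk' : (k : ℝ) ≠ 0 := by positivity
  have hk1 : (k : ℝ) - 1 ≠ 0 := by
    have : (2 : ℝ) ≤ k := by exact_mod_cast hk
    linarith
  have hn' : (n : ℝ) ≠ 0 := by positivity
  have hr' : r ≠ 0 := by rw [hr]; positivity
  have hprop : armProp Z z = r := by rw [armProp, mem_assignments.1 hZ, hr]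
  have hmean : armMean Z Y z = mean Y + (∑ i, y i * dev z k Z i) / k := by
    rw [hy]; exact armMean_eq_mean_add (by omega) hZ Y
  have hcent : ∀ i, Y i - armMean Z Y z = y i - (∑ i, y i * dev z k Z i) / k := by
    intro i; rw [hmean, hy]; ring
  set L := ∑ i, y i * dev z k Z i with hL
  set G := ∑ i, (∑ j, hat X i j * y j) * dev z k Z i with hG
  set M := ∑ i, hat X i i * y i * dev z k Z i with hM
  set h := ∑ i, hat X i i * y i with hh
  set V := ∑ i, ind z Z i * ∑ j, hat X i j * (ind z Z j * 1) with hV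
  set P := ∑ i, hat X i i * ind z Z i with hP
  have e1 : armMean Z (fun i => Y i - betaHat X Z Y z ⬝ᵥ centered X i) z
      = mean Y + L / k - c * ((r * G + (1 - 2 * r) * M + r * (1 - r) * h + offDiag X z k y Z)
        - V * (L / k)) := by
    have hsplit : ∑ i, (Y i - betaHat X Z Y z ⬝ᵥ centered X i) * ind z Z i
        = ∑ i, Y i * ind z Z i - ∑ i, betaHat X Z Y z ⬝ᵥ centered X i * ind z Z i := by
      rw [← Finset.sum_sub_distrib]
      exact Finset.sum_congr rfl fun i _ => sub_mul _ _ _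
    rw [armMean_eq hZ, hsplit, sub_div, ← armMean_eq hZ, hmean, hr, hG, hM, hh, ← sum_hat_ind]
    congr 1
    rw [hV, Finset.sum_mul, ← Finset.sum_sub_distrib, Finset.mul_sum, Finset.sum_div]
    refine Finset.sum_congr rfl fun i _ => ?_
    rw [betaHat_dotProduct hn X hZ]
    have : ∑ j, hat X i j * (ind z Z j * (Y j - armMean Z Y z))
        = ∑ j, hat X i j * (ind z Z j * y j) - (∑ j, hat X i j * (ind z Z j * 1)) * (L / k) := by
      rw [Finset.sum_mul, ← Finset.sum_sub_distrib]
      refine Finset.sum_congr rfl fun j _ => ?_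
      rw [hcent]
      ring
    rw [this, hc]
    field_simp
  have e2 : armMean Z (fun i => hat X i i * ((Y i - armMean Z Y z) / r ^ 2)) z
      = (M + r * h - P * (L / k)) / r ^ 2 / k := by
    rw [armMean_eq hZ, hM, hh, hP, Finset.mul_sum, Finset.sum_mul, ← Finset.sum_add_distrib,
      ← Finset.sum_sub_distrib]
    simp only [Finset.sum_div]
    refine Finset.sum_congr rfl fun i _ => ?_
    rw [hcent, ind_eq_dev_add z k Z i, ← hr]
    ring
  have e3 : ∑ i, resid X Y i * ind z Z i = L - G := by
    rw [← sum_mul_dev (k := k) (sum_resid hn X Y), hL, hG, ← Finset.sum_sub_distrib]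
    refine Finset.sum_congr rfl fun i _ => ?_
    rw [resid_eq hn, hy]
    ring
  have hkr : (k : ℝ) = r * n := by rw [hr]; field_simp
  rw [armEst, hprop, e1, e2, e3, hc]
  have hrn1 : r * n - 1 ≠ 0 := by rw [← hkr]; exact hk1
  rw [hkr]
  field_simp
  ring

/-- The squared entries of column j of H sum to H_jj, so the squared Frobenius norm of the form is
at most ∑ H_jj y_j². -/
lemma expect_offDiag_sq_le (hn : 6 ≤ n) {X : Matrix (Fin n) (Fin p) ℝ}
    (hX : IsUnit (covMatrix X).det) {z : Fin 2} {k : ℕ} (hk : k ≤ n) (y : Fin n → ℝ) :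
    𝔼 Z ∈ assignments n z k, offDiag X z k y Z ^ 2 ≤ 42 * ∑ i, hat X i i * y i ^ 2 := by
  refine (expect_quadratic_sq_le hk hn (fun i j => if i = j then 0 else hat X i j * y j)
    (by simp)).trans (mul_le_mul_of_nonneg_left ?_ (by norm_num))
  rw [Finset.sum_comm]
  refine Finset.sum_le_sum fun j _ => ?_
  rw [← sum_hat_sq (by omega) hX, Finset.sum_mul]
  refine Finset.sum_le_sum fun i _ => ?_
  split_ifs
  · rw [zero_pow two_ne_zero]
    positivity
  · rw [mul_pow, hat_comm]

lemma expect_hat_diag_sq_le (hn : 2 ≤ n) {X : Matrix (Fin n) (Fin p) ℝ}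
    (hX : IsUnit (covMatrix X).det) {z : Fin 2} {k : ℕ} (hk : k ≤ n) (y : Fin n → ℝ) :
    𝔼 Z ∈ assignments n z k, (∑ i, hat X i i * y i * dev z k Z i) ^ 2
      ≤ 3 * ∑ i, hat X i i * y i ^ 2 := by
  refine (expect_linear_sq_le hk hn fun i => hat X i i * y i).trans ?_
  gcongr with i
  have h0 := hat_self_nonneg hn hX i
  have h1 := hat_self_le_one hn hX i
  nlinarith [mul_nonneg (mul_nonneg h0 (sub_nonneg.2 h1)) (sq_nonneg (y i))]

/-- The expansion of `sum_hat_ind` for the constant outcome 1: its first linear part vanishes as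
rows of H sum to zero. The square of a sum of three terms costs a factor 3, and 3 · (3 + 42) = 135.
-/
lemma expect_hat_ind_sq_le (hn : 6 ≤ n) {X : Matrix (Fin n) (Fin p) ℝ}
    (hX : IsUnit (covMatrix X).det) {z : Fin 2} {k : ℕ} (hk : k ≤ n) :
    𝔼 Z ∈ assignments n z k, (∑ i, ind z Z i * ∑ j, hat X i j * (ind z Z j * 1)) ^ 2
      ≤ 135 * p + 3 * p ^ 2 := by
  have hn2 : 2 ≤ n := by omega
  have hn' : (0 : ℝ) < n := by positivity
  have hr0 : 0 ≤ (k : ℝ) / n := by positivity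
  have hr1 : (k : ℝ) / n ≤ 1 := div_le_one_of_le₀ (by exact_mod_cast hk) hn'.le
  have h1 := expect_hat_diag_sq_le (z := z) hn2 hX hk fun _ => 1
  have h2 := expect_offDiag_sq_le (z := z) hn hX hk fun _ => 1
  simp only [one_pow, mul_one, sum_hat_self hn2 hX] at h1 h2
  have h3 : ∀ Z ∈ assignments n z k, (∑ i, ind z Z i * ∑ j, hat X i j * (ind z Z j * 1)) ^ 2
      ≤ 3 * (∑ i, hat X i i * dev z k Z i) ^ 2 + 3 * p ^ 2
        + 3 * offDiag X z k (fun _ => 1) Z ^ 2 := by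
    intro Z _
    rw [sum_hat_ind X z k (fun _ => 1) Z]
    simp only [mul_one, sum_hat, zero_mul, Finset.sum_const_zero, mul_zero, zero_add,
      sum_hat_self hn2 hX]
    set r := (k : ℝ) / n
    set M := ∑ i, hat X i i * dev z k Z i
    set Q := offDiag X z k (fun _ => 1) Z
    have e1 : (1 - 2 * r) ^ 2 * M ^ 2 ≤ M ^ 2 :=
      mul_le_of_le_one_left (sq_nonneg _) (by nlinarith)
    have hrr : 0 ≤ r * (1 - r) := mul_nonneg hr0 (sub_nonneg.2 hr1)
    have e2 : (r * (1 - r)) ^ 2 * (p : ℝ) ^ 2 ≤ (p : ℝ) ^ 2 :=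
      mul_le_of_le_one_left (sq_nonneg _) (pow_le_one₀ hrr (by nlinarith))
    nlinarith [sq_nonneg ((1 - 2 * r) * M - r * (1 - r) * p), sq_nonneg ((1 - 2 * r) * M - Q),
      sq_nonneg (r * (1 - r) * p - Q)]
  refine (Finset.expect_le_expect h3).trans ?_
  rw [Finset.expect_add_distrib, Finset.expect_add_distrib, ← Finset.mul_expect,
    ← Finset.mul_expect (f := fun Z => offDiag X z k (fun _ => 1) Z ^ 2), Finset.expect_const (assignments_nonempty hk)]
  linarith

lemma expect_abs_mul_le_sqrt {α : Type*} {s : Finset α} {f g : α → ℝ} {a b : ℝ} (ha : 0 ≤ a)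
    (hf : 𝔼 x ∈ s, f x ^ 2 ≤ a) (hg : 𝔼 x ∈ s, g x ^ 2 ≤ b) : 𝔼 x ∈ s, |f x * g x| ≤ √(a * b) := by
  refine Real.le_sqrt_of_sq_le ?_
  have h := Finset.expect_mul_sq_le_sq_mul_sq s (fun x => |f x|) (fun x => |g x|)
  simp only [sq_abs, ← abs_mul] at h
  exact h.trans (mul_le_mul hf hg (Finset.expect_nonneg fun _ _ => sq_nonneg _) ha)

/-- The bookkeeping of powers of n in the remainder, with N = n and q = √n. -/
lemma mul_remainder_le {N q D p g h m o v l x₁ x₂ x₃ x₄ x₅ : ℝ} (hN : 0 ≤ N) (hqN : q * q = N)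
    (hq : 1 ≤ q) (hD : 0 ≤ D) (hp : 0 ≤ p) (hx₂ : 0 ≤ x₂) (hg : g ≤ q * x₁) (hh : h ≤ N * x₂)
    (hm : m ≤ q * x₃) (ho : o ≤ q * x₄) (hv : v ≤ N * (q * x₅)) (hl : l ≤ q * x₁) :
    q * (D / N ^ 2 * g + D / N ^ 2 * h + D / N * m + D / N * o + D / N ^ 2 * v
        + D / N ^ 2 * (p * l))
      ≤ D * (x₁ / N + x₂ + x₃ + x₄ + x₅ + p / N * x₁) := by
  have hq0 : 0 < q := by linarith
  have hx : D * x₂ / q ≤ D * x₂ := div_le_self (mul_nonneg hD hx₂) hq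
  calc _ ≤ q * (D / N ^ 2 * (q * x₁) + D / N ^ 2 * (N * x₂) + D / N * (q * x₃)
        + D / N * (q * x₄) + D / N ^ 2 * (N * (q * x₅)) + D / N ^ 2 * (p * (q * x₁))) := by
        gcongr
    _ = D * x₁ / N + D * x₂ / q + D * x₃ + D * x₄ + D * x₅ + D * p / N * x₁ := by
        rw [← hqN]
        field_simp
    _ ≤ D * x₁ / N + D * x₂ + D * x₃ + D * x₄ + D * x₅ + D * p / N * x₁ := by gcongr
    _ = _ := by ring

/-- The contribution of an arm is, up to a remainder of smaller order than `n ^ (-1/2)`, the arm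
average of the regression residuals. -/
lemma sqrt_mul_expect_abs_armEst_sub_le (hn : 6 ≤ n) {X : Matrix (Fin n) (Fin p) ℝ}
    (hX : IsUnit (covMatrix X).det) {z : Fin 2} {k : ℕ} (hk2 : 2 ≤ k) (hk : k ≤ n) {ρ A K : ℝ}
    (hρ : 0 < ρ) (hρk : ρ * n ≤ k) {Y : Fin n → ℝ}
    (hA : ∑ i, (Y i - mean Y) ^ 2 ≤ n * A) (hK : ∑ i, hat X i i * (Y i - mean Y) ^ 2 ≤ n * K)
    (hK0 : 0 ≤ K) :
    √(n : ℝ) * 𝔼 Z ∈ assignments n z k,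
        |armEst X Z Y z - mean Y - (∑ i, resid X Y i * ind z Z i) / k|
      ≤ 3 / ρ ^ 3 * (√(3 * A) / n + √(p / n * K) + √(3 * K) + √(42 * K)
        + √((135 * (p / n) / n + 3 * (p / n) ^ 2) * (3 * A)) + p / n * √(3 * A)) := by
  have hn2 : 2 ≤ n := by omega
  have hn' : (0 : ℝ) < n := by positivity
  have hnn : (6 : ℝ) ≤ n := by exact_mod_cast hn
  have hkR : (2 : ℝ) ≤ k := by exact_mod_cast hk2
  have hknR : (k : ℝ) ≤ n := by exact_mod_cast hk
  have hρ1 : ρ ≤ 1 := by nlinarith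
  set y : Fin n → ℝ := fun i => Y i - mean Y with hy
  set r : ℝ := (k : ℝ) / n with hr
  set c : ℝ := ((n : ℝ) - 1) / (k * (k - 1)) with hc
  have hr1 : r ≤ 1 := div_le_one_of_le₀ hknR hn'.le
  have hrρ : ρ ≤ r := by rwa [hr, le_div_iff₀ hn']
  have hr0 : 0 < r := hρ.trans_le hrρ
  have hkr : (k : ℝ) = r * n := by rw [hr]; field_simp
  have hp0 : (0 : ℝ) ≤ p := by positivity
  set D : ℝ := 3 / ρ ^ 3 with hD
  have hD0 : 0 < D := by positivity
  -- the coefficients of the remainder terms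
  have hρn : 0 < ρ * n := by positivity
  -- Since k ≥ 2, k(k - 1) ≥ k²/2.
  have hkk : (ρ * n) ^ 2 / 2 ≤ k * (k - 1) := by nlinarith
  have hD2 : 3 / ρ ^ 2 ≤ D := by
    rw [hD, div_le_div_iff₀ (by positivity) (by positivity)]
    have : ρ ^ 3 ≤ ρ ^ 2 := by nlinarith [sq_nonneg ρ]
    linarith
  have hinv : 1 / ((k : ℝ) * (k - 1)) ≤ 2 / ρ ^ 2 / n ^ 2 := by
    calc 1 / ((k : ℝ) * (k - 1)) ≤ 1 / ((ρ * n) ^ 2 / 2) := by gcongr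
      _ = _ := by field_simp
  have hkk0 : 0 < (k : ℝ) * (k - 1) := by nlinarith
  have h2ρ : 0 ≤ 1 / ρ ^ 2 := by positivity
  have h23 : 2 / ρ ^ 2 ≤ D := by
    have : 3 / ρ ^ 2 = 2 / ρ ^ 2 + 1 / ρ ^ 2 := by ring
    linarith
  have hc0 : 0 ≤ c := div_nonneg (by linarith) hkk0.le
  have hc2 : c ≤ 2 / ρ ^ 2 / n := by
    calc c = (n - 1) * (1 / ((k : ℝ) * (k - 1))) := by rw [hc]; ring
      _ ≤ n * (2 / ρ ^ 2 / n ^ 2) := by gcongr; linarith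
      _ = _ := by field_simp
  have c1 : |-((1 - r) / ((k : ℝ) * (k - 1)))| ≤ D / n ^ 2 := by
    rw [abs_neg, abs_of_nonneg (div_nonneg (by linarith) hkk0.le)]
    calc (1 - r) / ((k : ℝ) * (k - 1)) ≤ 1 / (k * (k - 1)) := by gcongr; linarith
      _ ≤ 2 / ρ ^ 2 / n ^ 2 := hinv
      _ ≤ _ := by gcongr
  have c2 : |(1 - r) ^ 2 / ((k : ℝ) * (k - 1))| ≤ D / n ^ 2 := by
    rw [abs_of_nonneg (div_nonneg (by positivity) hkk0.le)]
    calc (1 - r) ^ 2 / ((k : ℝ) * (k - 1)) ≤ 1 / (k * (k - 1)) := by gcongr; nlinarith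
      _ ≤ 2 / ρ ^ 2 / n ^ 2 := hinv
      _ ≤ _ := by gcongr
  have c3 : |(1 - r) / (r * k) - (1 - 2 * r) * c| ≤ D / n := by
    have e1 : (1 - r) / (r * k) ≤ 1 / ρ ^ 2 / n := by
      rw [hkr]
      calc (1 - r) / (r * (r * n)) ≤ 1 / (ρ * (ρ * n)) := by gcongr; linarith
        _ = _ := by field_simp
    have e0 : 0 ≤ (1 - r) / (r * k) := div_nonneg (by linarith) (by positivity)
    have e2 : |(1 - 2 * r) * c| ≤ 2 / ρ ^ 2 / n := by
      rw [abs_mul, abs_of_nonneg hc0]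
      refine le_trans (mul_le_of_le_one_left hc0 ?_) hc2
      rw [abs_le]; constructor <;> linarith
    have e3 : 1 / ρ ^ 2 / n + 2 / ρ ^ 2 / n ≤ D / n := by
      rw [← add_div, ← add_div]
      gcongr
      norm_num
      exact hD2
    rw [abs_le] at e2 ⊢
    constructor <;> linarith
  have c4 : |c| ≤ D / n := by
    rw [abs_of_nonneg hc0]
    exact hc2.trans (by gcongr)
  have c5 : |c / k| ≤ D / n ^ 2 := by
    rw [abs_of_nonneg (by positivity)]
    calc c / k ≤ 2 / ρ ^ 2 / n / (ρ * n) := by gcongr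
      _ = 2 / ρ ^ 3 / n ^ 2 := by field_simp
      _ ≤ _ := by rw [hD]; gcongr; norm_num
  have c6 : |(1 - r) / (r * k ^ 2)| ≤ D / n ^ 2 := by
    rw [abs_of_nonneg (div_nonneg (by linarith) (by positivity))]
    calc (1 - r) / (r * k ^ 2) ≤ 1 / (ρ * (ρ * n) ^ 2) := by gcongr; linarith
      _ = 1 / ρ ^ 3 / n ^ 2 := by field_simp
      _ ≤ _ := by rw [hD]; gcongr; norm_num
  -- the moments of the remainder terms
  set G : (Fin n → Fin 2) → ℝ := fun Z => ∑ i, (∑ j, hat X i j * y j) * dev z k Z i with hG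
  set M : (Fin n → Fin 2) → ℝ := fun Z => ∑ i, hat X i i * y i * dev z k Z i with hM
  set V : (Fin n → Fin 2) → ℝ := fun Z => ∑ i, ind z Z i * ∑ j, hat X i j * (ind z Z j * 1) with hV
  set L : (Fin n → Fin 2) → ℝ := fun Z => ∑ i, y i * dev z k Z i with hL
  set h : ℝ := ∑ i, hat X i i * y i with hh
  set P : (Fin n → Fin 2) → ℝ := fun Z => ∑ i, hat X i i * ind z Z i with hP
  have mG : 𝔼 Z ∈ assignments n z k, |G Z| ≤ √n * √(3 * A) := by
    rw [← Real.sqrt_mul hn'.le]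
    refine expect_abs_le_sqrt ((expect_linear_sq_le hk hn2 _).trans ?_)
    linarith [(sum_sq_hat_mul_le hn2 hX y).trans hA]
  have mL2 : 𝔼 Z ∈ assignments n z k, L Z ^ 2 ≤ n * (3 * A) := by
    refine (expect_linear_sq_le hk hn2 _).trans ?_
    linarith
  have mL : 𝔼 Z ∈ assignments n z k, |L Z| ≤ √n * √(3 * A) := by
    rw [← Real.sqrt_mul hn'.le]
    exact expect_abs_le_sqrt mL2
  have mM : 𝔼 Z ∈ assignments n z k, |M Z| ≤ √n * √(3 * K) := by
    rw [← Real.sqrt_mul hn'.le]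
    refine expect_abs_le_sqrt ((expect_hat_diag_sq_le hn2 hX hk _).trans ?_)
    linarith
  have mQ : 𝔼 Z ∈ assignments n z k, |offDiag X z k y Z| ≤ √n * √(42 * K) := by
    rw [← Real.sqrt_mul hn'.le]
    refine expect_abs_le_sqrt ((expect_offDiag_sq_le hn hX hk _).trans ?_)
    linarith
  -- Cauchy–Schwarz with weights H_ii, whose total mass is p.
  have mh : |h| ≤ n * √(p / n * K) := by
    refine abs_le_of_sq_le_sq ?_ (by positivity)
    rw [mul_pow, Real.sq_sqrt (by positivity)]
    have h1 := Finset.sum_mul_sq_le_sq_mul_sq Finset.univ (fun i => √(hat X i i))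
      (fun i => √(hat X i i) * y i)
    have h2 : ∀ i, √(hat X i i) ^ 2 = hat X i i := fun i => Real.sq_sqrt (hat_self_nonneg hn2 hX i)
    simp only [mul_pow, h2, ← mul_assoc, ← sq, sum_hat_self hn2 hX] at h1
    calc h ^ 2 ≤ p * (n * K) := h1.trans (by gcongr)
      _ = n ^ 2 * (p / n * K) := by field_simp
  have mVL : 𝔼 Z ∈ assignments n z k, |V Z * L Z|
      ≤ n * (√n * √((135 * (p / n) / n + 3 * (p / n) ^ 2) * (3 * A))) := by
    refine (expect_abs_mul_le_sqrt (by positivity) (expect_hat_ind_sq_le hn hX hk) mL2).trans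
      (le_of_eq ?_)
    rw [← Real.sqrt_mul hn'.le, ← Real.sqrt_sq hn'.le, ← Real.sqrt_mul (sq_nonneg _),
      Real.sqrt_sq hn'.le]
    congr 1
    field_simp
  have mPL : ∀ Z, |P Z * L Z| ≤ p * |L Z| := by
    intro Z
    rw [abs_mul]
    gcongr
    have h0 : 0 ≤ P Z := Finset.sum_nonneg fun i _ =>
      mul_nonneg (hat_self_nonneg hn2 hX i) (ind_nonneg _ _ _)
    rw [abs_of_nonneg h0, ← sum_hat_self hn2 hX]
    exact Finset.sum_le_sum fun i _ =>
      mul_le_of_le_one_right (hat_self_nonneg hn2 hX i) (ind_le_one _ _ _)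
  have hR : ∀ Z ∈ assignments n z k,
      |armEst X Z Y z - mean Y - (∑ i, resid X Y i * ind z Z i) / k|
        ≤ D / n ^ 2 * |G Z| + D / n ^ 2 * |h| + D / n * |M Z| + D / n * |offDiag X z k y Z|
          + D / n ^ 2 * |V Z * L Z| + D / n ^ 2 * (p * |L Z|) := by
    intro Z hZ
    rw [armEst_sub_eq hn2 X hk2 hZ Y hr hc hy]
    have b : ∀ {u v d : ℝ}, |u| ≤ d → |u * v| ≤ d * |v| := fun {u v d} hu => by
      rw [abs_mul]; exact mul_le_mul_of_nonneg_right hu (abs_nonneg v)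
    have b1 := b (v := G Z) c1
    have b2 := b (v := h) c2
    have b3 := b (v := M Z) c3
    have b4 := b (v := offDiag X z k y Z) c4
    have b5 := b (v := V Z * L Z) c5
    have b6 := (b (v := P Z * L Z) c6).trans
      (mul_le_mul_of_nonneg_left (mPL Z) (by positivity))
    rw [abs_le] at b1 b2 b3 b4 b5 b6 ⊢
    constructor <;> linarith
  have hE := Finset.expect_le_expect hR
  simp only [Finset.expect_add_distrib, ← Finset.mul_expect,
    Finset.expect_const (assignments_nonempty hk)] at hE
  refine (mul_le_mul_of_nonneg_left hE (Real.sqrt_nonneg _)).trans ?_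
  refine mul_remainder_le hn'.le (Real.mul_self_sqrt hn'.le) ?_ hD0.le hp0 (Real.sqrt_nonneg _)
    mG mh mM mQ mVL mL
  rw [Real.one_le_sqrt]
  linarith

/-! ### The debiased estimator is asymptotically linear -/

lemma integral_completeRandomization {k : ℕ} (g : (Fin n → Fin 2) → ℂ) :
    ∫ Z, g Z ∂(completeRandomization n k) = 𝔼 Z ∈ assignments n 1 k, g Z := by
  have hset : ({Z | armSize Z 1 = k} : Set (Fin n → Fin 2)) = (assignments n 1 k : Set _) := by
    ext Z
    simp [mem_assignments]
  rw [completeRandomization, hset, uniformOn, ProbabilityTheory.cond, integral_smul_measure,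
    setIntegral_finset _ Integrable.of_finite.integrableOn, Finset.expect_eq_sum_div_card]
  simp [Measure.count_apply_finset, div_eq_inv_mul]

/-- This allows the one-arm bounds, stated for either arm, to be added under a single expectation.
-/
lemma assignments_zero_eq {m : Fin 2 → ℕ} (hm : m 0 + m 1 = n) :
    assignments n 0 (m 0) = assignments n 1 (m 1) := by
  ext Z
  have h : armSize Z 0 + armSize Z 1 = n := by
    have h1 : ((armSize Z 0 + armSize Z 1 : ℕ) : ℝ) = n := by
      push_cast
      rw [armSize_eq_sum, armSize_eq_sum, ← Finset.sum_add_distrib]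
      have : ∀ i, ((if Z i = 0 then 1 else 0) + if Z i = 1 then 1 else 0 : ℝ) = 1 := by
        intro i
        rcases Fin.exists_fin_two.1 ⟨Z i, rfl⟩ with h | h <;> simp [h]
      simp [this]
    exact_mod_cast h1
  rw [mem_assignments, mem_assignments]
  omega

lemma ind_zero_eq (Z : Fin n → Fin 2) (i : Fin n) : ind 0 Z i = 1 - ind 1 Z i := by
  rcases Fin.exists_fin_two.1 ⟨Z i, rfl⟩ with h | h <;> simp [ind, h]

lemma armMean_congr {Z : Fin n → Fin 2} {a b : Fin n → ℝ} {z : Fin 2}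
    (h : ∀ i, Z i = z → a i = b i) : armMean Z a z = armMean Z b z := by
  rw [armMean, armMean]
  congr 1
  exact Finset.sum_congr rfl fun i hi => h i (Finset.mem_filter.1 hi).2

lemma armEst_observed (X : Matrix (Fin n) (Fin p) ℝ) (Z : Fin n → Fin 2) (Y : Fin 2 → Fin n → ℝ)
    (z : Fin 2) : armEst X Z (observed Y Z) z = armEst X Z (Y z) z := by
  have h0 : ∀ i, Z i = z → observed Y Z i = Y z i := fun i hi => by rw [observed, hi]
  have h1 : armMean Z (observed Y Z) z = armMean Z (Y z) z := armMean_congr h0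
  have h2 : betaHat X Z (observed Y Z) z = betaHat X Z (Y z) z := by
    rw [betaHat, betaHat]
    congr 1
    ext j
    rw [armCovVec, armCovVec, h1]
    congr 1
    exact Finset.sum_congr rfl fun i hi => by rw [h0 i (Finset.mem_filter.1 hi).2]
  rw [armEst, armEst, h1, h2]
  congr 1
  · exact armMean_congr fun i hi => by rw [h0 i hi]
  · congr 1
    exact armMean_congr fun i hi => by rw [h0 i hi]

lemma tauDb_eq (hn : 0 < n) (X : Matrix (Fin n) (Fin p) ℝ) {m : Fin 2 → ℕ} (hm : m 0 + m 1 = n)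
    {Z : Fin n → Fin 2} (hZ : Z ∈ assignments n 1 (m 1)) (Y : Fin 2 → Fin n → ℝ) :
    tauDb X Z (observed Y Z) = armEst X Z (Y 1) 1 - armEst X Z (Y 0) 0 := by
  have h1 : armProp Z 0 = 1 - armProp Z 1 := by
    have hn' : (n : ℝ) ≠ 0 := by positivity
    have hZ0 := hZ
    rw [← assignments_zero_eq hm] at hZ0
    rw [armProp, armProp, mem_assignments.1 hZ, mem_assignments.1 hZ0]
    field_simp
    rw [← hm]
    push_cast
    ring
  rw [← armEst_observed, ← armEst_observed, armEst, armEst, tauDb, tauAdj, h1]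
  ring

lemma ate_eq (Y : Fin 2 → Fin n → ℝ) : ate Y = mean (Y 1) - mean (Y 0) := by
  rw [ate, mean, mean, mean, Finset.sum_sub_distrib, sub_div]

lemma var_eq_of_sum_eq_zero {a : Fin n → ℝ} (ha : ∑ i, a i = 0) :
    var a = (∑ i, a i ^ 2) / ((n : ℝ) - 1) := by
  simp [var, cov, mean, ha, sq]

/-- The asymptotic variance is that of the arm averages of the residuals. -/
lemma sum_sq_resid_eq (hn : 2 ≤ n) (X : Matrix (Fin n) (Fin p) ℝ) {r : Fin 2 → ℝ}
    (hr : ∀ z, r z ≠ 0) (hr1 : r 0 + r 1 = 1) (Y : Fin 2 → Fin n → ℝ) :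
    r 1 * r 0 * ∑ i, (resid X (Y 1) i / r 1 + resid X (Y 0) i / r 0) ^ 2
      = ((n : ℝ) - 1) * sigmaAdjSq X r Y := by
  have hn1 : ((n : ℝ) - 1) ≠ 0 := by
    have : (2 : ℝ) ≤ n := by exact_mod_cast hn
    linarith
  have hsum : ∑ i, (resid X (Y 1) i - resid X (Y 0) i) = 0 := by
    rw [Finset.sum_sub_distrib, sum_resid hn, sum_resid hn, sub_zero]
  rw [sigmaAdjSq, var_eq_of_sum_eq_zero (sum_resid hn X (Y 1)),
    var_eq_of_sum_eq_zero (sum_resid hn X (Y 0)), var_eq_of_sum_eq_zero hsum]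
  have e : ∀ u v w : ℝ, ((n : ℝ) - 1) * ((r 1)⁻¹ * (u / (n - 1)) + (r 0)⁻¹ * (v / (n - 1))
      - w / (n - 1)) = (r 1)⁻¹ * u + (r 0)⁻¹ * v - w := by
    intro u v w
    field_simp
  rw [e, Finset.mul_sum, Finset.mul_sum, Finset.mul_sum, ← Finset.sum_add_distrib,
    ← Finset.sum_sub_distrib]
  refine Finset.sum_congr rfl fun i _ => ?_
  have h0 := hr 0
  have h1 := hr 1
  have h2 : r 0 = 1 - r 1 := by linarith
  rw [h2] at h0 ⊢
  field_simp
  ring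

/-! ### The characteristic function of the standardized estimator -/

lemma norm_cexp_sub_cexp_le (x y : ℝ) :
    ‖Complex.exp (x * Complex.I) - Complex.exp (y * Complex.I)‖ ≤ |x - y| := by
  have h : Complex.exp (x * Complex.I) - Complex.exp (y * Complex.I)
      = Complex.exp (y * Complex.I) * (Complex.exp (Complex.I * (x - y : ℝ)) - 1) := by
    rw [mul_sub, ← Complex.exp_add, mul_one]
    congr 2
    push_cast
    ring
  rw [h, norm_mul, Complex.norm_exp_ofReal_mul_I, one_mul]
  exact Real.norm_exp_I_mul_ofReal_sub_one_le

/-- The standardized debiased estimator, as a function of the assignment. -/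
def stdTauDb (X : Matrix (Fin n) (Fin p) ℝ) (m : Fin 2 → ℕ) (Y : Fin 2 → Fin n → ℝ)
    (Z : Fin n → Fin 2) : ℝ :=
  √(n : ℝ) * (tauDb X Z (observed Y Z) - ate Y) / √(sigmaAdjSq X (fun z => (m z : ℝ) / n) Y)

/-- The bound for `√n` times the remainder in the linearization of an arm. -/
def armBound (ρ A u π K : ℝ) : ℝ :=
  3 / ρ ^ 3 * (√(3 * A) * u + √(π * K) + √(3 * K) + √(42 * K)
    + √((135 * π * u + 3 * π ^ 2) * (3 * A)) + π * √(3 * A))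

/-- The characteristic function of the standardized debiased estimator is close to that of the
standard Gaussian. -/
lemma norm_expect_stdTauDb_sub_le (hn : 6 ≤ n) {X : Matrix (Fin n) (Fin p) ℝ}
    (hX : IsUnit (covMatrix X).det) {m : Fin 2 → ℕ} (hm : m 0 + m 1 = n) (hm2 : ∀ z, 2 ≤ m z)
    {Y : Fin 2 → Fin n → ℝ} {ρ A c ε : ℝ} {K : Fin 2 → ℝ} (hρ : 0 < ρ)
    (hρm : ∀ z, ρ ≤ (m z : ℝ) / n)
    (hA : ∀ z, ∑ i, (Y z i - mean (Y z)) ^ 2 ≤ n * A)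
    (hK : ∀ z, ∑ i, hat X i i * (Y z i - mean (Y z)) ^ 2 ≤ n * K z) (hK0 : ∀ z, 0 ≤ K z)
    (hc : 0 < c) (hcσ : c ≤ sigmaAdjSq X (fun z => (m z : ℝ) / n) Y)
    (hε : ∀ z i, |resid X (Y z) i| / √(n : ℝ) ≤ ε) (hε0 : 0 ≤ ε) {δ η : ℝ}
    (hδ : δ = 2 / (ρ * √c) * ε) (hη : η = δ * √(3 / ρ ^ 2) + (1 + 3 / ρ ^ 2) * (n : ℝ)⁻¹) (t : ℝ) :
    ‖𝔼 Z ∈ assignments n 1 (m 1), Complex.exp ((t * stdTauDb X m Y Z : ℝ) * Complex.I)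
        - Complex.exp (-(t ^ 2 / 2 : ℝ))‖
      ≤ |t| / √c * (armBound ρ A (n : ℝ)⁻¹ (p / n) (K 1) + armBound ρ A (n : ℝ)⁻¹ (p / n) (K 0))
        + |t| * (|t| * η + 2 * t ^ 2 * δ * (1 + η)) := by
  have hn2 : 2 ≤ n := by omega
  have hnp : 0 < n := by omega
  have hn' : (0 : ℝ) < n := by positivity
  have hmn : ∀ z, m z ≤ n := Fin.forall_fin_two.2 ⟨by omega, by omega⟩
  set S := assignments n 1 (m 1) with hS
  set σ2 := sigmaAdjSq X (fun z => (m z : ℝ) / n) Y with hσ2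
  have hσ0 : 0 < σ2 := hc.trans_le hcσ
  have hsc : 0 < √c := Real.sqrt_pos.2 hc
  have hcσ' : √c ≤ √σ2 := Real.sqrt_le_sqrt hcσ
  have hs0 : 0 < √σ2 := hsc.trans_le hcσ'
  have hsn : 0 < √(n : ℝ) := Real.sqrt_pos.2 hn'
  have hm0 : ∀ z, (0 : ℝ) < m z := fun z => by have := hm2 z; positivity
  have hr0 : ∀ z, 0 < (m z : ℝ) / n := fun z => div_pos (hm0 z) hn'
  have hr1 : (m 0 : ℝ) / n + (m 1 : ℝ) / n = 1 := by
    rw [← add_div, ← Nat.cast_add, hm, div_self hn'.ne']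
  have hr1' : 1 - (m 1 : ℝ) / n = (m 0 : ℝ) / n := by linarith
  set a : Fin n → ℝ := fun i =>
    (resid X (Y 1) i / ((m 1 : ℝ) / n) + resid X (Y 0) i / ((m 0 : ℝ) / n)) / (√n * √σ2) with ha
  have ha0 : ∑ i, a i = 0 := by
    rw [ha, ← Finset.sum_div, Finset.sum_add_distrib, ← Finset.sum_div, ← Finset.sum_div,
      sum_resid hn2, sum_resid hn2]
    simp
  -- The linear statistic has variance r(1 - r) · n/(n - 1) · ∑ aᵢ², so this says that it is exactly
  -- one.
  have hv : (m 1 : ℝ) / n * (1 - (m 1 : ℝ) / n) * ∑ i, a i ^ 2 = 1 - 1 / n := by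
    have h1 := sum_sq_resid_eq hn2 X (r := fun z => (m z : ℝ) / n) (fun z => (hr0 z).ne') hr1 Y
    have h2 : ∑ i, a i ^ 2 = (∑ i, (resid X (Y 1) i / ((m 1 : ℝ) / n)
        + resid X (Y 0) i / ((m 0 : ℝ) / n)) ^ 2) / (n * σ2) := by
      rw [Finset.sum_div]
      refine Finset.sum_congr rfl fun i _ => ?_
      rw [ha, div_pow, mul_pow, Real.sq_sqrt hn'.le, Real.sq_sqrt hσ0.le]
    rw [h2, ← mul_div_assoc, hr1', h1, ← hσ2]
    field_simp
  have hA2 : ∑ i, a i ^ 2 ≤ 1 / ρ ^ 2 := by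
    rw [le_div_iff₀ (by positivity)]
    have h1 : ρ * ρ ≤ (m 1 : ℝ) / n * (1 - (m 1 : ℝ) / n) := by
      rw [hr1']
      exact mul_le_mul (hρm 1) (hρm 0) hρ.le (hr0 1).le
    have h2 : (0 : ℝ) ≤ 1 / n := by positivity
    have h3 : 0 ≤ ∑ i, a i ^ 2 := by positivity
    nlinarith [mul_le_mul_of_nonneg_right h1 h3]
  have hδ0 : 0 ≤ δ := by rw [hδ]; positivity
  have haδ : ∀ i, |a i| ≤ δ := by
    intro i
    have h1 : ∀ z, |resid X (Y z) i / ((m z : ℝ) / n)| ≤ ε * √n / ρ := by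
      intro z
      rw [abs_div, abs_of_pos (hr0 z)]
      exact div_le_div₀ (by positivity) ((div_le_iff₀ hsn).1 (hε z i)) hρ (hρm z)
    have h2 := (abs_add_le _ _).trans (add_le_add (h1 1) (h1 0))
    rw [ha, abs_div, abs_of_pos (mul_pos hsn hs0), hδ]
    calc _ ≤ (ε * √n / ρ + ε * √n / ρ) / (√n * √c) := by gcongr
      _ = _ := by field_simp; ring
  have hηb : δ * √(3 * ∑ i, a i ^ 2) + (1 + 3 * ∑ i, a i ^ 2) / n ≤ η := by
    have h3 : 3 * ∑ i, a i ^ 2 ≤ 3 / ρ ^ 2 := by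
      have : 3 / ρ ^ 2 = 3 * (1 / ρ ^ 2) := by ring
      linarith
    rw [hη, ← div_eq_mul_inv]
    gcongr
  have hclt := norm_expect_cexp_sub_le (z := 1) (hmn 1) hn2 ha0 hv haδ hδ0 hηb t
  -- comparison with the linear statistic
  set R : Fin 2 → (Fin n → Fin 2) → ℝ := fun z Z =>
    armEst X Z (Y z) z - mean (Y z) - (∑ i, resid X (Y z) i * ind z Z i) / m z with hR
  have hlin : ∀ Z ∈ S, stdTauDb X m Y Z - ∑ l, a l * ind 1 Z l
      = √n / √σ2 * (R 1 Z - R 0 Z) := by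
    intro Z hZ
    -- Residuals sum to zero, so the control average can be written with the treatment indicators;
    -- this turns the difference of the arms into one linear statistic.
    have e0 : ∑ i, resid X (Y 0) i * ind 0 Z i = - ∑ i, resid X (Y 0) i * ind 1 Z i := by
      simp only [ind_zero_eq, mul_sub, mul_one, Finset.sum_sub_distrib, sum_resid hn2, zero_sub]
    have e1 : ∑ l, a l * ind 1 Z l = √n / √σ2 * ((∑ i, resid X (Y 1) i * ind 1 Z i) / m 1
        + (∑ i, resid X (Y 0) i * ind 1 Z i) / m 0) := by
      rw [Finset.sum_div, Finset.sum_div, ← Finset.sum_add_distrib, Finset.mul_sum]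
      refine Finset.sum_congr rfl fun i _ => ?_
      have hm0' := (hm0 0).ne'
      have hm1' := (hm0 1).ne'
      have hq : (n : ℝ) = √n * √n := (Real.mul_self_sqrt hn'.le).symm
      have hd : ∀ x d : ℝ, d ≠ 0 → x / (d / n) / (√n * √σ2) = √n / √σ2 * (x / d) := by
        intro x d hd
        rw [div_div_eq_mul_div, div_div, div_mul_div_comm,
          div_eq_div_iff (by positivity) (by positivity)]
        linear_combination (x * √σ2 * d) * hq
      rw [ha]
      simp only [add_div]
      rw [hd _ _ hm1', hd _ _ hm0']
      ring
    rw [stdTauDb, tauDb_eq hnp X hm hZ, ate_eq, e1, hR]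
    simp only [e0]
    ring
  have hcomp : ‖𝔼 Z ∈ S, Complex.exp ((t * stdTauDb X m Y Z : ℝ) * Complex.I)
      - 𝔼 Z ∈ S, Complex.exp ((t * ∑ l, a l * ind 1 Z l : ℝ) * Complex.I)‖
      ≤ |t| / √c * (√n * 𝔼 Z ∈ S, |R 1 Z| + √n * 𝔼 Z ∈ S, |R 0 Z|) := by
    rw [← Finset.expect_sub_distrib, ← mul_add, ← Finset.expect_add_distrib, ← mul_assoc,
      Finset.mul_expect]
    refine (norm_expect_le _ _).trans (Finset.expect_le_expect fun Z hZ => ?_)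
    refine (norm_cexp_sub_cexp_le _ _).trans ?_
    rw [← mul_sub, hlin Z hZ, abs_mul, abs_mul, abs_of_pos (div_pos hsn hs0)]
    calc |t| * (√n / √σ2 * |R 1 Z - R 0 Z|) ≤ |t| * (√n / √c * (|R 1 Z| + |R 0 Z|)) := by
          gcongr
          exact abs_sub _ _
      _ = _ := by ring
  have hb : ∀ z, √n * 𝔼 Z ∈ assignments n z (m z), |R z Z|
      ≤ armBound ρ A (n : ℝ)⁻¹ (p / n) (K z) := by
    intro z
    have h := sqrt_mul_expect_abs_armEst_sub_le (z := z) hn hX (hm2 z) (hmn z) hρ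
      ((le_div_iff₀ hn').1 (hρm z)) (hA z) (hK z) (hK0 z)
    simpa only [armBound, hR, div_eq_mul_inv, mul_assoc] using h
  have hb1 := hb 1
  have hb0 := hb 0
  rw [assignments_zero_eq hm] at hb0
  have htri := norm_add_le
    (𝔼 Z ∈ S, Complex.exp ((t * stdTauDb X m Y Z : ℝ) * Complex.I)
      - 𝔼 Z ∈ S, Complex.exp ((t * ∑ l, a l * ind 1 Z l : ℝ) * Complex.I))
    (𝔼 Z ∈ S, Complex.exp ((t * ∑ l, a l * ind 1 Z l : ℝ) * Complex.I)
      - Complex.exp (-(t ^ 2 / 2 : ℝ)))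
  rw [sub_add_sub_cancel] at htri
  refine htri.trans (add_le_add (hcomp.trans ?_) hclt)
  gcongr

/-- The bound is continuous in the three small quantities and vanishes when all of them do. -/
lemma tendsto_armBound {ρ A : ℝ} {u π K : ℕ → ℝ} (hu : Tendsto u atTop (𝓝 0))
    (hπ : Tendsto π atTop (𝓝 0)) (hK : Tendsto K atTop (𝓝 0)) :
    Tendsto (fun n => armBound ρ A (u n) (π n) (K n)) atTop (𝓝 0) := by
  have hcont : Continuous fun v : ℝ × ℝ × ℝ => armBound ρ A v.1 v.2.1 v.2.2 := by
    unfold armBound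
    fun_prop
  have h := (hcont.tendsto (0, 0, 0)).comp (hu.prodMk_nhds (hπ.prodMk_nhds hK))
  simpa [armBound, Function.comp_def] using h

lemma charFun_map_eq_expect {Ω : Type*} [MeasurableSpace Ω] {P : Measure Ω} {n k : ℕ}
    {Z : Ω → Fin n → Fin 2} (hZ : HasLaw Z (completeRandomization n k) P)
    (f : (Fin n → Fin 2) → ℝ) (t : ℝ) :
    charFun (P.map fun ω => f (Z ω)) t
      = 𝔼 z ∈ assignments n 1 k, Complex.exp ((t * f z : ℝ) * Complex.I) := by
  have hf : Measurable f := measurable_of_finite f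
  have h1 : P.map (fun ω => f (Z ω)) = (completeRandomization n k).map f := by
    rw [← hZ.map_eq, AEMeasurable.map_map_of_aemeasurable hf.aemeasurable hZ.aemeasurable]
    rfl
  rw [h1, charFun_apply_real, integral_map hf.aemeasurable (by fun_prop),
    integral_completeRandomization]
  simp

end RegAdj

end

/-! ### The limit theorem -/

theorem theorem1
    -- the `n`-th experiment: `m n z` units in arm `z`, `p n` covariates, potential outcomes `Y n z i`
    (m : ℕ → Fin 2 → ℕ) (hm : ∀ n, m n 0 + m n 1 = n)
    (p : ℕ → ℕ) (X : (n : ℕ) → Matrix (Fin n) (Fin (p n)) ℝ)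
    (Y : (n : ℕ) → Fin 2 → Fin n → ℝ)
    -- completely randomized assignments
    {Ω : ℕ → Type*} [∀ n, MeasurableSpace (Ω n)]
    (P : (n : ℕ) → Measure (Ω n)) [∀ n, IsProbabilityMeasure (P n)]
    (Z : (n : ℕ) → Ω n → Fin n → Fin 2)
    (hZ : ∀ n, HasLaw (Z n) (RegAdj.completeRandomization n (m n 1)) (P n))
    -- the inverse covariance matrix of the covariates exists for all large `n`
    (hX : ∀ᶠ n in atTop, IsUnit (RegAdj.covMatrix (X n)).det)
    -- the proportions of units in the two arms have limits in `(0, 1)`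
    (h1 : ∀ z : Fin 2, ∃ ρ ∈ Set.Ioo (0 : ℝ) 1,
      Tendsto (fun n : ℕ => (m n z : ℝ) / n) atTop (𝓝 ρ))
    -- bounded second moments
    (h2 : ∀ z : Fin 2, (fun n : ℕ => ∑ i, (Y n z i - RegAdj.mean (Y n z)) ^ 2)
      =O[atTop] (fun n : ℕ => (n : ℝ)))
    -- Lindeberg-type conditions
    (h3 : Tendsto (fun n : ℕ => ⨆ z : Fin 2, ⨆ i : Fin n,
        |Y n z i - RegAdj.mean (Y n z)| / √(n : ℝ)) atTop (𝓝 0))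
    (h3' : Tendsto (fun n : ℕ => ⨆ z : Fin 2, ⨆ i : Fin n,
        |RegAdj.resid (X n) (Y n z) i| / √(n : ℝ)) atTop (𝓝 0))
    -- the asymptotic variance is bounded away from zero
    (h4 : 0 < liminf (fun n : ℕ =>
      ((RegAdj.sigmaAdjSq (X n) (fun z => (m n z : ℝ) / n) (Y n) : ℝ) : EReal)) atTop)
    -- `p = o(n)`, and the `p` largest squared centred potential outcomes sum to `o(n)`
    (h5 : Tendsto (fun n : ℕ => (p n : ℝ) / n) atTop (𝓝 0))
    (h5' : ∀ z : Fin 2, (fun n : ℕ =>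
        RegAdj.sumLargest (p n) (fun i => (Y n z i - RegAdj.mean (Y n z)) ^ 2))
      =o[atTop] (fun n : ℕ => (n : ℝ))) :
    TendstoInDistribution
      (fun (n : ℕ) (ω : Ω n) =>
        √(n : ℝ) * (RegAdj.tauDb (X n) (Z n ω) (RegAdj.observed (Y n) (Z n ω)) - RegAdj.ate (Y n))
          / √(RegAdj.sigmaAdjSq (X n) (fun z => (m n z : ℝ) / n) (Y n)))
      atTop (id : ℝ → ℝ) P (gaussianReal 0 1) := by
  have hinv : Tendsto (fun n : ℕ => (n : ℝ)⁻¹) atTop (𝓝 0) := tendsto_inv_atTop_nhds_zero_nat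
  -- uniform constants
  obtain ⟨ρ₀, hρ₀, hlim₀⟩ := h1 0
  obtain ⟨ρ₁, hρ₁, hlim₁⟩ := h1 1
  obtain ⟨ρ, hρ, hρm⟩ : ∃ ρ > (0 : ℝ), ∀ᶠ n : ℕ in atTop, ∀ z, ρ ≤ (m n z : ℝ) / n := by
    refine ⟨min ρ₀ ρ₁ / 2, by have := lt_min hρ₀.1 hρ₁.1; linarith, ?_⟩
    have e0 : min ρ₀ ρ₁ / 2 < ρ₀ := by
      have := min_le_left ρ₀ ρ₁; have := hρ₀.1; linarith
    have e1 : min ρ₀ ρ₁ / 2 < ρ₁ := by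
      have := min_le_right ρ₀ ρ₁; have := hρ₁.1; linarith
    filter_upwards [hlim₀.eventually_const_le e0, hlim₁.eventually_const_le e1] with n h0 h1
    exact Fin.forall_fin_two.2 ⟨h0, h1⟩
  obtain ⟨A, hA⟩ : ∃ A : ℝ, ∀ᶠ n : ℕ in atTop, ∀ z,
      ∑ i, (Y n z i - RegAdj.mean (Y n z)) ^ 2 ≤ n * A := by
    obtain ⟨A₀, hA₀⟩ := (h2 0).bound
    obtain ⟨A₁, hA₁⟩ := (h2 1).bound
    refine ⟨max A₀ A₁, ?_⟩
    filter_upwards [hA₀, hA₁] with n h0 h1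
    have hn : ‖(n : ℝ)‖ = n := Real.norm_natCast n
    rw [hn] at h0 h1
    have hn0 : (0 : ℝ) ≤ n := Nat.cast_nonneg n
    refine Fin.forall_fin_two.2 ⟨?_, ?_⟩
    · nlinarith [(le_abs_self _).trans h0, mul_le_mul_of_nonneg_left (le_max_left A₀ A₁) hn0]
    · nlinarith [(le_abs_self _).trans h1, mul_le_mul_of_nonneg_left (le_max_right A₀ A₁) hn0]
  obtain ⟨c, hc, hcσ⟩ : ∃ c > (0 : ℝ), ∀ᶠ n : ℕ in atTop,
      c ≤ RegAdj.sigmaAdjSq (X n) (fun z => (m n z : ℝ) / n) (Y n) := by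
    obtain ⟨c, hc0, hc1⟩ := EReal.lt_iff_exists_real_btwn.1 h4
    refine ⟨c, by exact_mod_cast hc0, ?_⟩
    filter_upwards [eventually_lt_of_lt_liminf hc1] with n hn
    exact_mod_cast hn.le
  -- vanishing sequences
  set ε : ℕ → ℝ := fun n => ⨆ z : Fin 2, ⨆ i : Fin n, |RegAdj.resid (X n) (Y n z) i| / √(n : ℝ)
    with hε
  have hεle : ∀ n z i, |RegAdj.resid (X n) (Y n z) i| / √(n : ℝ) ≤ ε n := fun n z i =>
    (le_ciSup (f := fun i => |RegAdj.resid (X n) (Y n z) i| / √(n : ℝ))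
      (Set.finite_range _).bddAbove i).trans
      (le_ciSup (f := fun z => ⨆ i : Fin n, |RegAdj.resid (X n) (Y n z) i| / √(n : ℝ))
        (Set.finite_range _).bddAbove z)
  have hε0 : ∀ n, 0 ≤ ε n := fun n =>
    Real.iSup_nonneg fun z => Real.iSup_nonneg fun i => by positivity
  -- This bounds n⁻¹ ∑ H_ii y_i² once p < n; the absolute value makes nonnegativity immediate.
  set K : ℕ → Fin 2 → ℝ := fun n z =>
    |RegAdj.sumLargest (p n) (fun i => (Y n z i - RegAdj.mean (Y n z)) ^ 2) / n| with hK
  have hK0 : ∀ z, Tendsto (fun n => K n z) atTop (𝓝 0) := fun z => by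
    have := ((h5' z).tendsto_div_nhds_zero).abs
    rwa [abs_zero] at this
  set δ : ℕ → ℝ := fun n => 2 / (ρ * √c) * ε n with hδ
  set η : ℕ → ℝ := fun n => δ n * √(3 / ρ ^ 2) + (1 + 3 / ρ ^ 2) * (n : ℝ)⁻¹ with hη
  have hδ0 : Tendsto δ atTop (𝓝 0) := by simpa using h3'.const_mul (2 / (ρ * √c))
  have hη0 : Tendsto η atTop (𝓝 0) := by
    simpa using (hδ0.mul_const (√(3 / ρ ^ 2))).add (hinv.const_mul (1 + 3 / ρ ^ 2))
  -- convergence of the characteristic functions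
  have hbound : ∀ t : ℝ, ∀ᶠ n : ℕ in atTop,
      ‖𝔼 z ∈ RegAdj.assignments n 1 (m n 1),
          Complex.exp ((t * RegAdj.stdTauDb (X n) (m n) (Y n) z : ℝ) * Complex.I)
        - Complex.exp (-(t ^ 2 / 2 : ℝ))‖
      ≤ |t| / √c * (RegAdj.armBound ρ A (n : ℝ)⁻¹ (p n / n) (K n 1)
          + RegAdj.armBound ρ A (n : ℝ)⁻¹ (p n / n) (K n 0))
        + |t| * (|t| * η n + 2 * t ^ 2 * δ n * (1 + η n)) := by
    intro t
    -- From n ≥ 2/ρ both arms have at least two units, and p/n < 1 provides the entry next after the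
    -- p largest.
    filter_upwards [hρm, hA, hcσ, hX, eventually_ge_atTop 6,
      h5.eventually_lt_const (zero_lt_one' ℝ),
      (tendsto_natCast_atTop_atTop (R := ℝ)).eventually_ge_atTop (2 / ρ)]
      with n hρm hA hcσ hX hn hpn hnρ
    have hn' : (0 : ℝ) < n := by positivity
    have hm2 : ∀ z, 2 ≤ m n z := fun z => by
      have h1 := (le_div_iff₀ hn').1 (hρm z)
      rw [div_le_iff₀ hρ] at hnρ
      have : (2 : ℝ) ≤ m n z := by linarith
      exact_mod_cast this
    have hpn' : p n < n := by
      rw [div_lt_one hn'] at hpn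
      exact_mod_cast hpn
    refine RegAdj.norm_expect_stdTauDb_sub_le (K := K n) (δ := δ n) (η := η n) hn hX (hm n) hm2 hρ hρm hA (fun z => ?_)
      (fun z => abs_nonneg _) hc hcσ (hεle n) (hε0 n) rfl rfl t
    have hn2 : 2 ≤ n := by omega
    refine (RegAdj.sum_mul_le_sumLargest (RegAdj.hat_self_nonneg hn2 hX)
      (RegAdj.hat_self_le_one hn2 hX) (RegAdj.sum_hat_self hn2 hX) hpn').trans ?_
    have h := le_abs_self
      (RegAdj.sumLargest (p n) (fun i => (Y n z i - RegAdj.mean (Y n z)) ^ 2) / n)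
    rwa [div_le_iff₀ hn', mul_comm] at h
  have hzero : ∀ t : ℝ, Tendsto (fun n : ℕ =>
      |t| / √c * (RegAdj.armBound ρ A (n : ℝ)⁻¹ (p n / n) (K n 1)
          + RegAdj.armBound ρ A (n : ℝ)⁻¹ (p n / n) (K n 0))
        + |t| * (|t| * η n + 2 * t ^ 2 * δ n * (1 + η n))) atTop (𝓝 0) := by
    intro t
    have b1 := ((RegAdj.tendsto_armBound (ρ := ρ) (A := A) hinv h5 (hK0 1)).add
      (RegAdj.tendsto_armBound (ρ := ρ) (A := A) hinv h5 (hK0 0))).const_mul (|t| / √c)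
    have b2 := ((hη0.const_mul |t|).add
      ((hδ0.const_mul (2 * t ^ 2)).mul (hη0.const_add 1))).const_mul |t|
    simpa using b1.add b2
  refine ⟨fun n => ?_, aemeasurable_id, ?_⟩
  · exact (measurable_of_finite (RegAdj.stdTauDb (X n) (m n) (Y n))).comp_aemeasurable
      (hZ n).aemeasurable
  -- Lévy's continuity theorem: pointwise convergence of characteristic functions suffices.
  · refine ProbabilityMeasure.tendsto_of_tendsto_charFun fun t => ?_
    have hg : charFun ((gaussianReal 0 1).map (id : ℝ → ℝ)) t
        = Complex.exp (-(t ^ 2 / 2 : ℝ)) := by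
      rw [Measure.map_id, charFun_gaussianReal]
      congr 1
      push_cast
      ring
    have hlaw : ∀ n, charFun ((P n).map fun ω => RegAdj.stdTauDb (X n) (m n) (Y n) (Z n ω)) t
        = 𝔼 z ∈ RegAdj.assignments n 1 (m n 1),
          Complex.exp ((t * RegAdj.stdTauDb (X n) (m n) (Y n) z : ℝ) * Complex.I) :=
      fun n => RegAdj.charFun_map_eq_expect (hZ n) _ t
    have hlim := tendsto_iff_norm_sub_tendsto_zero.2
      (squeeze_zero' (Eventually.of_forall fun _ => norm_nonneg _) (hbound t) (hzero t))
    simp only [← hlaw, ← hg] at hlim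
    exact hlim
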